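/- Let $M$ be a smooth manifold (Hausdorff, $\sigma$-compact, finite dimensional, without boundary), let $A\to M$ be a Lie algebroid with anchor $\rho$, and let $E\to M$ be a smooth real vector bundle of finite rank. Write $\Omega^\bullet(A)=\Gamma(\wedge^\bullet A^*)$, with Lie algebroid differential $\mathbf d_A$ and cohomology $H^\bullet(A)$. For a linear $A$-connection $\tilde\nabla$ on $E$ with curvature $R_{\tilde\nabla}\in\Omega^2(A,\operatorname{End}E)$ and for $i\ge 1$, let $\operatorname{tr}(R_{\tilde\nabla}^i)\in\Omega^{2i}(A)$ be the fibrewise trace of the $i$-fold wedge power of $R_{\tilde\nabla}$. These forms are closed, and so are their wedge products; the class of $\operatorname{tr}(R_{\tilde\nabla}^i)$ in $H^{2i}(A)$ does not depend on $\tilde\nabla$. Let $\operatorname{Pont}^\bullet_A(E)\subseteq H^\bullet(A)$ be the $\mathbb R$-subalgebra generated by the classes $[\operatorname{tr}(R_{\tilde\nabla}^i)]$, $i\geq 1$, and let $\operatorname{Pont}^l_A(E)\subseteq H^l(A)$ be its part of degree $l$. Let $B\subseteq A$ be a Lie subalgebroid over $M$ of codimension $q=\operatorname{rank}A-\operatorname{rank}B$,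 and let $\nabla\colon\Gamma(B)\times\Gamma(E)\to\Gamma(E)$ be a flat $B$-connection (a representation of $B$ on $E$). Together with the Bott connection $\nabla^B_b\bar a=\overline{[b,a]}$ on $A/B$ it induces a flat $B$-connection on $\operatorname{Hom}(A/B,\operatorname{End}E)$. For an extension $\tilde\nabla$ of $\nabla$ to an $A$-connection on $E$, the form $\omega_{\tilde\nabla}\in\Omega^1(B,\operatorname{Hom}(A/B,\operatorname{End}E))$, $\omega_{\tilde\nabla}(b,\bar a)e=R_{\tilde\nabla}(b,a)e$, is closed; its class $\alpha_\nabla=[\omega_{\tilde\nabla}]\in H^1(B,\operatorname{Hom}(A/B,\operatorname{End}E))$, the Atiyah class of $\nabla$, does not depend on the choice of the extension. Theorem. If $\alpha_\nabla=0$, then $\operatorname{Pont}^l_A(E)=0$ for all $l>q$. -/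

import Mathlib

open scoped Manifold ContDiff Topology Bundle
open Bundle

noncomputable section

namespace LieRinehart

section Algebra

/-! ### Connections, curvature and cohomology

`C` is the algebra of smooth functions, `L` the module of sections of a Lie algebroid, with its
bracket `⁅a, b⁆` and its action `⁅a, f⁆ = ρ(a)(f)` on functions. A `k`-form with values in a module
`N` of sections is an alternating `C`-multilinear map from `k` copies of `L` to `N`. -/

variable {C L N N' : Type*} [CommRing C] [LieRing L] [Module C L] [LieRingModule L C]
  [AddCommGroup N] [Module C N] [AddCommGroup N'] [Module C N']

variable (C L N) in
/-- A linear `L`-connection on the `C`-module `N`: a map `(a, n) ↦ ∇_a n` which is additive in both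
arguments, `C`-linear in `a`, and satisfies `∇_a (f n) = f ∇_a n + ρ(a)(f) n`. -/
structure Connection where
  toFun : L → N → N
  add_left' : ∀ a b n, toFun (a + b) n = toFun a n + toFun b n
  smul_left' : ∀ (f : C) a n, toFun (f • a) n = f • toFun a n
  add_right' : ∀ a n m, toFun a (n + m) = toFun a n + toFun a m
  leibniz' : ∀ a (f : C) n, toFun a (f • n) = f • toFun a n + ⁅a, f⁆ • n

namespace Connection

instance : CoeFun (Connection C L N) (fun _ => L → N → N) := ⟨Connection.toFun⟩

variable (D : Connection C L N) (D' : Connection C L N')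

lemma add_left (a b : L) (n : N) : D (a + b) n = D a n + D b n := D.add_left' a b n
lemma smul_left (f : C) (a : L) (n : N) : D (f • a) n = f • D a n := D.smul_left' f a n
lemma add_right (a : L) (n m : N) : D a (n + m) = D a n + D a m := D.add_right' a n m
lemma leibniz (a : L) (f : C) (n : N) : D a (f • n) = f • D a n + ⁅a, f⁆ • n := D.leibniz' a f n

lemma zero_right (a : L) : D a 0 = 0 := by
  have := D.add_right a 0 0
  simpa using this

lemma neg_right (a : L) (n : N) : D a (-n) = -D a n := by
  have := D.add_right a n (-n)
  rw [add_neg_cancel, zero_right] at this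
  exact (neg_eq_of_add_eq_zero_right this.symm).symm

lemma sub_right (a : L) (n m : N) : D a (n - m) = D a n - D a m := by
  rw [sub_eq_add_neg, add_right, neg_right, sub_eq_add_neg]

lemma neg_left (a : L) (n : N) : D (-a) n = -D a n := by
  have := D.smul_left (-1) a n
  simpa using this

lemma sub_left (a b : L) (n : N) : D (a - b) n = D a n - D b n := by
  rw [sub_eq_add_neg, add_left, neg_left, sub_eq_add_neg]

/-- A connection is flat if it is a representation: `∇_a ∇_b - ∇_b ∇_a = ∇_[a,b]`. -/
def IsFlat : Prop := ∀ a b n, D a (D b n) - D b (D a n) = D ⁅a, b⁆ n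

/-- The connection induced on `Hom(N, N')`: `(∇_a φ)(n) = ∇_a (φ n) - φ (∇_a n)`. -/
def hom : Connection C L (N →ₗ[C] N') where
  toFun a φ :=
    { toFun := fun n => D' a (φ n) - φ (D a n)
      map_add' := fun n m => by simp only [map_add, add_right]; abel
      map_smul' := fun f n => by
        simp only [map_smul, map_add, leibniz, RingHom.id_apply, smul_sub]; abel }
  add_left' a b φ := by
    ext n; simp only [LinearMap.coe_mk, AddHom.coe_mk, LinearMap.add_apply, add_left, map_add]; abel
  smul_left' f a φ := by
    ext n; simp only [LinearMap.coe_mk, AddHom.coe_mk, LinearMap.smul_apply, smul_left, map_smul,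
      smul_sub]
  add_right' a φ ψ := by
    ext n; simp only [LinearMap.coe_mk, AddHom.coe_mk, LinearMap.add_apply, add_right]; abel
  leibniz' a f φ := by
    ext n; simp only [LinearMap.coe_mk, AddHom.coe_mk, LinearMap.add_apply, LinearMap.smul_apply,
      leibniz, smul_sub]; abel

@[simp] lemma hom_apply (a : L) (φ : N →ₗ[C] N') (n : N) :
    (D.hom D') a φ n = D' a (φ n) - φ (D a n) := rfl

section LR
variable [LieRinehartRing C L]

variable (C L) in
/-- The canonical flat connection `∇_a f = ρ(a)(f)` on `C`. -/
def trivial : Connection C L C where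
  toFun a f := ⁅a, f⁆
  add_left' a b f := add_lie a b f
  smul_left' f a g := by simp
  add_right' a f g := lie_add a f g
  leibniz' a f g := by simp

/-- The curvature endomorphism `R(a,b) = ∇_a ∇_b - ∇_b ∇_a - ∇_[a,b]`. -/
def curvatureEnd (a b : L) : Module.End C N where
  toFun n := D a (D b n) - D b (D a n) - D ⁅a, b⁆ n
  map_add' n m := by simp only [add_right]; abel
  map_smul' f n := by
    have h : ⁅⁅a, b⁆, f⁆ = ⁅a, ⁅b, f⁆⁆ - ⁅b, ⁅a, f⁆⁆ := lie_lie a b f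
    simp only [leibniz, add_right, h, RingHom.id_apply, smul_sub, sub_smul]; abel

lemma curvatureEnd_apply (a b : L) (n : N) :
    D.curvatureEnd a b n = D a (D b n) - D b (D a n) - D ⁅a, b⁆ n := rfl

lemma curvatureEnd_swap (a b : L) : D.curvatureEnd a b = -D.curvatureEnd b a := by
  ext n
  rw [LinearMap.neg_apply, curvatureEnd_apply, curvatureEnd_apply, ← lie_skew a b, neg_left]; abel

lemma curvatureEnd_add_left (a a' b : L) :
    D.curvatureEnd (a + a') b = D.curvatureEnd a b + D.curvatureEnd a' b := by
  ext n
  simp only [LinearMap.add_apply, curvatureEnd_apply, add_lie, add_left, add_right]; abel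

lemma curvatureEnd_smul_left (f : C) (a b : L) :
    D.curvatureEnd (f • a) b = f • D.curvatureEnd a b := by
  ext n
  have h : ⁅f • a, b⁆ = f • ⁅a, b⁆ - ⁅b, f⁆ • a := by
    rw [← lie_skew, LieRinehartRing.leibniz_smul_right, ← lie_skew a b, smul_neg]; abel
  simp only [LinearMap.smul_apply, curvatureEnd_apply, h, smul_left, sub_left, leibniz, smul_sub]
  abel

lemma curvatureEnd_add_right (a b b' : L) :
    D.curvatureEnd a (b + b') = D.curvatureEnd a b + D.curvatureEnd a b' := by
  rw [curvatureEnd_swap, curvatureEnd_add_left, D.curvatureEnd_swap a b, D.curvatureEnd_swap a b']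
  abel

lemma curvatureEnd_smul_right (f : C) (a b : L) :
    D.curvatureEnd a (f • b) = f • D.curvatureEnd a b := by
  rw [curvatureEnd_swap, curvatureEnd_smul_left, D.curvatureEnd_swap a b, smul_neg]

lemma curvatureEnd_self (a : L) : D.curvatureEnd a a = 0 := by
  ext n; simp only [curvatureEnd_apply, lie_self, LinearMap.zero_apply, sub_self, zero_sub]
  have := D.smul_left 0 a n
  simpa using this

/-- The curvature `R_∇ ∈ Ω²(L, End N)`. -/
def curvature : L [⋀^Fin 2]→ₗ[C] Module.End C N where
  toFun v := D.curvatureEnd (v 0) (v 1)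
  map_update_add' v i x y := by
    fin_cases i <;> simp [curvatureEnd_add_left, curvatureEnd_add_right]
  map_update_smul' v i f x := by
    fin_cases i <;> simp [curvatureEnd_smul_left, curvatureEnd_smul_right]
  map_eq_zero_of_eq' v i j h hij := by
    have h01 : v 0 = v 1 := by
      fin_cases i <;> fin_cases j <;> first | exact absurd rfl hij | exact h | exact h.symm
    simp only [h01, curvatureEnd_self]

end LR

end Connection

/-- The value on `(a_0, …, a_k)` of the covariant exterior derivative `d_∇ θ` of a `k`-form `θ`
with values in `N` (Koszul formula):
`∑_i (-1)^i (∇_{a_i} (θ(a_0, …, â_i, …, a_k))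
  - ∑_{j > i} θ(a_0, …, â_i, …, a_{j-1}, [a_i, a_j], a_{j+1}, …, a_k))`.
Moving `[a_i, a_j]` to the first slot gives the familiar terms
`(-1)^(i+j) θ([a_i, a_j], a_0, …, â_i, …, â_j, …, a_k)`. In the code, `j : Fin k` indexes the tuple
from which `a_i` has been removed, so its entries after `a_i` are those with `i ≤ j`. -/
def koszul (D : Connection C L N) {k : ℕ} (θ : L [⋀^Fin k]→ₗ[C] N) (a : Fin (k + 1) → L) : N :=
  ∑ i : Fin (k + 1), (-1 : ℤ) ^ (i : ℕ) •
    (D (a i) (θ (i.removeNth a)) -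
      ∑ j : Fin k with i ≤ j.castSucc,
        θ (Function.update (i.removeNth a) j ⁅a i, i.removeNth a j⁆))

lemma koszul_add (D : Connection C L N) {k : ℕ} (θ η : L [⋀^Fin k]→ₗ[C] N) (a) :
    koszul D (θ + η) a = koszul D θ a + koszul D η a := by
  simp only [koszul, AlternatingMap.add_apply, D.add_right, Finset.sum_add_distrib,
    add_sub_add_comm, smul_add]

section Real

variable [Algebra ℝ C] [LieAlgebra ℝ L] [LieRinehartRing C L] [LieRinehartAlgebra ℝ C L]
  [Module ℝ N] [IsScalarTower ℝ C N]

lemma lie_algebraMap (a : L) (r : ℝ) : ⁅a, algebraMap ℝ C r⁆ = 0 := by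
  have h1 : ⁅a, (1 : C)⁆ = 0 := by
    have := LieRinehartRing.leibniz_mul_right a (1 : C) 1
    simpa using this
  rw [Algebra.algebraMap_eq_smul_one, lie_smul, h1, smul_zero]

lemma Connection.real_smul_right (D : Connection C L N) (a : L) (r : ℝ) (n : N) :
    D a (r • n) = r • D a n := by
  rw [← algebraMap_smul C r n, D.leibniz, lie_algebraMap, zero_smul, add_zero, algebraMap_smul]

lemma koszul_smul (D : Connection C L N) {k : ℕ} (r : ℝ) (θ : L [⋀^Fin k]→ₗ[C] N) (a) :
    koszul D (r • θ) a = r • koszul D θ a := by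
  simp only [koszul, AlternatingMap.smul_apply, D.real_smul_right, Finset.smul_sum, smul_sub]
  refine Finset.sum_congr rfl fun i _ => ?_
  simp only [smul_comm r]

/-- The closed `k`-forms: `d_∇ θ = 0`. -/
def closedForms (D : Connection C L N) (k : ℕ) : Submodule ℝ (L [⋀^Fin k]→ₗ[C] N) where
  carrier := {θ | ∀ a, koszul D θ a = 0}
  add_mem' h h' a := by rw [koszul_add, h a, h' a, add_zero]
  zero_mem' a := by simpa using koszul_smul D (0 : ℝ) (0 : L [⋀^Fin k]→ₗ[C] N) a
  smul_mem' r θ h a := by rw [koszul_smul, h a, smul_zero]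

/-- The exact `k`-forms: those of the form `d_∇ θ` with `θ` a `(k-1)`-form. -/
def exactForms (D : Connection C L N) : (k : ℕ) → Submodule ℝ (L [⋀^Fin k]→ₗ[C] N)
  | 0 => ⊥
  | k + 1 =>
    { carrier := {η | ∃ θ : L [⋀^Fin k]→ₗ[C] N, ∀ a, η a = koszul D θ a}
      add_mem' := by
        rintro η η' ⟨θ, h⟩ ⟨θ', h'⟩
        exact ⟨θ + θ', fun a => by rw [koszul_add, AlternatingMap.add_apply, h, h']⟩
      zero_mem' := ⟨0, fun a => by simpa using (koszul_smul D (0 : ℝ) (0 : L [⋀^Fin k]→ₗ[C] N) a).symm⟩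
      smul_mem' := by
        rintro r η ⟨θ, h⟩
        exact ⟨r • θ, fun a => by rw [koszul_smul, AlternatingMap.smul_apply, h]⟩ }

/-- The `k`-th cohomology of `L` with coefficients in `(N, ∇)`: closed `k`-forms modulo exact
`k`-forms. (It is used for flat `∇` only.) -/
def Cohomology (D : Connection C L N) (k : ℕ) : Type _ :=
  closedForms D k ⧸ (exactForms D k).submoduleOf (closedForms D k)

namespace Cohomology

variable (D : Connection C L N) (k : ℕ)

instance : AddCommGroup (Cohomology D k) :=
  inferInstanceAs (AddCommGroup (closedForms D k ⧸ (exactForms D k).submoduleOf (closedForms D k)))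

instance : Module ℝ (Cohomology D k) :=
  inferInstanceAs (Module ℝ (closedForms D k ⧸ (exactForms D k).submoduleOf (closedForms D k)))

variable {D k} in
/-- The cohomology class of a closed form. -/
def mk (θ : L [⋀^Fin k]→ₗ[C] N) (hθ : θ ∈ closedForms D k) : Cohomology D k :=
  Submodule.Quotient.mk (p := (exactForms D k).submoduleOf (closedForms D k)) ⟨θ, hθ⟩

variable {D k} in
/-- A class vanishes exactly if the form is exact. -/
lemma mk_eq_zero_iff (θ : L [⋀^Fin k]→ₗ[C] N) (hθ : θ ∈ closedForms D k) :
    mk θ hθ = 0 ↔ θ ∈ exactForms D k :=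
  (Submodule.Quotient.mk_eq_zero _).trans Iff.rfl

end Cohomology

end Real

/-- The wedge product of forms with values in an algebra `S`:
`(θ ∧ η)(a_1, …, a_{k+l}) = ∑_σ sgn(σ) θ(a_{σ(1)}, …, a_{σ(k)}) η(a_{σ(k+1)}, …, a_{σ(k+l)})`,
the sum running over the `(k, l)`-shuffles. -/
def wedge {S : Type*} [Ring S] [Algebra C S] {k l : ℕ}
    (θ : L [⋀^Fin k]→ₗ[C] S) (η : L [⋀^Fin l]→ₗ[C] S) : L [⋀^Fin (k + l)]→ₗ[C] S :=
  ((LinearMap.mul' C S).compAlternatingMap (θ.domCoprod η)).domDomCongr finSumFinEquiv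

/-- The wedge powers `R^i = R ∧ … ∧ R`, of degree `2i`, of a 2-form `R` with values in `S`. -/
def wedgePow {S : Type*} [Ring S] [Algebra C S]
    (R : L [⋀^Fin 2]→ₗ[C] S) : (i : ℕ) → L [⋀^Fin (2 * i)]→ₗ[C] S
  | 0 => AlternatingMap.constOfIsEmpty C L (Fin 0) 1
  | i + 1 => wedge (wedgePow R i) R

section Sub
variable [LieRinehartRing C L] (B : LieRinehartSubalgebra C L)

/-- The Bott connection of `B ⊆ L` on `L/B`: `∇_b (a mod B) = [b, a] mod B`. -/
def bott : Connection C B (L ⧸ B.toSubmodule) where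
  toFun b := QuotientAddGroup.map _ _ (AddMonoidHom.mk' (fun a : L => ⁅(b : L), a⁆) (lie_add _))
    (fun a ha => B.lie_mem b.2 ha)
  add_left' b b' n := by
    obtain ⟨a, rfl⟩ := B.toSubmodule.mkQ_surjective n
    exact congrArg B.toSubmodule.mkQ (add_lie (b : L) b' a)
  smul_left' f b n := by
    obtain ⟨a, rfl⟩ := B.toSubmodule.mkQ_surjective n
    refine (Submodule.Quotient.eq B.toSubmodule).2 ?_
    have h : ⁅f • (b : L), a⁆ - f • ⁅(b : L), a⁆ = -(⁅a, f⁆ • (b : L)) := by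
      rw [← lie_skew, LieRinehartRing.leibniz_smul_right, ← lie_skew (b : L) a, smul_neg]; abel
    exact h ▸ B.toSubmodule.neg_mem (B.toSubmodule.smul_mem _ b.2)
  add_right' b n m := map_add _ n m
  leibniz' b f n := by
    obtain ⟨a, rfl⟩ := B.toSubmodule.mkQ_surjective n
    exact congrArg B.toSubmodule.mkQ (LieRinehartRing.leibniz_smul_right (b : L) a f)

variable {B} {V : Type*} [AddCommGroup V] [Module C V]

/-- An extension of a `B`-connection on `V` to an `L`-connection on `V`. -/
structure Extension (D : Connection C B V) where
  conn : Connection C L V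
  apply_coe : ∀ (b : B) (e : V), conn (b : L) e = D b e

lemma Extension.curvature_eq_zero {D : Connection C B V} (hD : D.IsFlat) (E : Extension D)
    (b b' : B) : E.conn.curvatureEnd (b : L) (b' : L) = 0 := by
  ext e
  have := E.apply_coe ⁅b, b'⁆ e
  rw [LieRinehartSubalgebra.coe_bracket] at this
  rw [Connection.curvatureEnd_apply, this]
  simp only [E.apply_coe, LinearMap.zero_apply]
  rw [← hD, sub_self]

/-- For an extension of the flat `B`-connection `D` with curvature `R`, the map
`b ↦ (a mod B ↦ R(b, a))`. -/
def atiyahHom {D : Connection C B V} (hD : D.IsFlat) (E : Extension D) :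
    B →ₗ[C] ((L ⧸ B.toSubmodule) →ₗ[C] Module.End C V) where
  toFun b := B.toSubmodule.liftQ
    { toFun := fun a => E.conn.curvatureEnd (b : L) a
      map_add' := fun a a' => E.conn.curvatureEnd_add_right _ a a'
      map_smul' := fun f a => E.conn.curvatureEnd_smul_right f _ a }
    (fun b' hb' => E.curvature_eq_zero hD b ⟨b', hb'⟩)
  map_add' b b' := by
    ext a e
    exact congrArg (fun φ => φ e) (E.conn.curvatureEnd_add_left (b : L) b' a)
  map_smul' f b := by
    ext a e
    exact congrArg (fun φ => φ e) (E.conn.curvatureEnd_smul_left f (b : L) a)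

lemma atiyahHom_mk {D : Connection C B V} (hD : D.IsFlat) (E : Extension D) (b : B) (a : L) (e : V) :
    atiyahHom hD E b (B.toSubmodule.mkQ a) e = E.conn.curvatureEnd (b : L) a e := rfl

/-- The form `θ ∈ Ω¹(B, Hom(L/B, End V))`, `θ(b, a mod B) = R(b, a)`. -/
def atiyahForm {D : Connection C B V} (hD : D.IsFlat) (E : Extension D) :
    B [⋀^Fin 1]→ₗ[C] ((L ⧸ B.toSubmodule) →ₗ[C] Module.End C V) :=
  AlternatingMap.ofSubsingleton C B _ (0 : Fin 1) (atiyahHom hD E)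

variable (B) in
/-- The `B`-connection on `Hom(L/B, End V)` induced by the Bott connection on `L/B` and the
`B`-connection `D` on `V`. -/
def atiyahConnection (D : Connection C B V) :
    Connection C B ((L ⧸ B.toSubmodule) →ₗ[C] Module.End C V) :=
  (bott B).hom (D.hom D)

lemma koszul_atiyahForm {D : Connection C B V} (hD : D.IsFlat) (E : Extension D)
    (v : Fin 2 → B) : koszul (atiyahConnection B D) (atiyahForm hD E) v = 0 := by
  have h : koszul (atiyahConnection B D) (atiyahForm hD E) v =
      atiyahConnection B D (v 0) (atiyahHom hD E (v 1)) -
      atiyahConnection B D (v 1) (atiyahHom hD E (v 0)) - atiyahHom hD E ⁅v 0, v 1⁆ := by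
    simp [koszul, Fin.sum_univ_succ, atiyahForm, Fin.removeNth, Finset.filter_singleton]
    abel
  rw [h]
  ext a e
  obtain ⟨b, hb⟩ : ∃ b, b = v 0 := ⟨_, rfl⟩
  obtain ⟨b', hb'⟩ : ∃ b, b = v 1 := ⟨_, rfl⟩
  rw [← hb, ← hb']
  have key : ∀ (b b' : B), atiyahConnection B D b (atiyahHom hD E b') (B.toSubmodule.mkQ a) e =
      D b (E.conn.curvatureEnd (b' : L) a e) - E.conn.curvatureEnd (b' : L) a (D b e)
       - E.conn.curvatureEnd (b' : L) ⁅(b : L), a⁆ e := fun b b' => rfl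
  have k2 := key b b'
  have k3 := key b' b
  have hf := hD b b'
  have hc : E.conn ⁅(b : L), (b' : L)⁆ = D ⁅b, b'⁆ := funext (E.apply_coe ⁅b, b'⁆)
  have hj1 : ⁅(b : L), ⁅(b' : L), a⁆⁆ = ⁅⁅(b : L), (b' : L)⁆, a⁆ + ⁅(b' : L), ⁅(b : L), a⁆⁆ :=
    leibniz_lie _ _ _
  simp only [LinearMap.comp_apply, LinearMap.sub_apply, LinearMap.zero_apply]
  rw [k2, k3, atiyahHom_mk]
  simp only [Connection.curvatureEnd_apply, E.apply_coe, LieRinehartSubalgebra.coe_bracket, hc,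
    hj1, Connection.add_left, Connection.sub_right]
  simp only [← hf, Connection.sub_right]
  abel

section RealB

variable [Algebra ℝ C] [LieAlgebra ℝ L] [LieRinehartAlgebra ℝ C L] [Module ℝ V] [IsScalarTower ℝ C V]

open Classical in
/-- The Atiyah class `[θ] ∈ H¹(B, Hom(L/B, End V))` of the flat `B`-connection `D` on `V`, computed
from some extension of `D` to an `L`-connection (for Lie algebroids an extension always exists, and
the class does not depend on it). -/
def atiyahClass (D : Connection C B V) (hD : D.IsFlat) :
    Cohomology (atiyahConnection B D) 1 :=
  if h : Nonempty (Extension D) then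
    Cohomology.mk (atiyahForm hD h.some) (koszul_atiyahForm hD h.some)
  else 0

end RealB

end Sub

section Pont
variable [LieRinehartRing C L] {V : Type*} [AddCommGroup V] [Module C V]

/-- The form `tr(R_∇^i) ∈ Ω^{2i}(L)`, for a trace map `tr : End V → C`. -/
def characterForm (tr : Module.End C V →ₗ[C] C) (D : Connection C L V) (i : ℕ) :
    L [⋀^Fin (2 * i)]→ₗ[C] C :=
  tr.compAlternatingMap (wedgePow D.curvature i)

/-- The products `tr(R_∇^{i_1}) ∧ … ∧ tr(R_∇^{i_m})` with `m ≥ 0` and all `i_j ≥ 1`, a form of degree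
`l = 2 (i_1 + … + i_m)`. -/
inductive IsPontryaginForm (tr : Module.End C V →ₗ[C] C) (D : Connection C L V) :
    (l : ℕ) → (L [⋀^Fin l]→ₗ[C] C) → Prop
  | one : IsPontryaginForm tr D 0 (AlternatingMap.constOfIsEmpty C L (Fin 0) 1)
  | mul {i l : ℕ} {θ : L [⋀^Fin l]→ₗ[C] C} (hi : 1 ≤ i) (hθ : IsPontryaginForm tr D l θ) :
      IsPontryaginForm tr D (2 * i + l) (wedge (characterForm tr D i) θ)

variable [Algebra ℝ C] [LieAlgebra ℝ L] [LieRinehartAlgebra ℝ C L]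

/-- The degree `l` part of the real subalgebra of the cohomology of `L` that is generated by the
classes `[tr(R_∇^i)]`, `i ≥ 1`: the span of the classes of the products of these forms in degree
`l`. No connection is singled out: all connections `∇` on `V` are admitted. -/
def pontryaginSpace (tr : Module.End C V →ₗ[C] C) (l : ℕ) :
    Submodule ℝ (Cohomology (Connection.trivial C L) l) :=
  Submodule.span ℝ {c | ∃ (D : Connection C L V) (θ : L [⋀^Fin l]→ₗ[C] C)
    (hθ : θ ∈ closedForms (Connection.trivial C L) l),
    IsPontryaginForm tr D l θ ∧ c = Cohomology.mk θ hθ}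

end Pont

end Algebra

section Manifold

/-! ### Lie algebroids over smooth manifolds -/

variable {d : ℕ} {M : Type*} [TopologicalSpace M] [ChartedSpace (EuclideanSpace ℝ (Fin d)) M]
  {F : Type*} [NormedAddCommGroup F] [NormedSpace ℝ F]
  {E : M → Type*} [TopologicalSpace (TotalSpace F E)] [∀ x, TopologicalSpace (E x)]
  [∀ x, AddCommGroup (E x)] [∀ x, Module ℝ (E x)] [FiberBundle F E] [VectorBundle ℝ F E]

/-- `Γ(E)` is a `C^∞(M)`-module. -/
instance smoothSectionsSMul : SMul C^∞⟮𝓡 d, M; ℝ⟯ Cₛ^∞⟮𝓡 d; F, E⟯ where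
  smul f s := ⟨fun x => f x • s x, f.contMDiff.smul_section s.contMDiff⟩

@[simp] lemma smoothSections_smul_apply (f : C^∞⟮𝓡 d, M; ℝ⟯) (s : Cₛ^∞⟮𝓡 d; F, E⟯) (x : M) :
    (f • s) x = f x • s x := rfl

instance smoothSectionsModule : Module C^∞⟮𝓡 d, M; ℝ⟯ Cₛ^∞⟮𝓡 d; F, E⟯ where
  one_smul s := by ext x; exact one_smul ℝ (s x)
  mul_smul f g s := by ext x; exact mul_smul (f x) (g x) (s x)
  smul_zero f := by ext x; exact smul_zero (f x)
  smul_add f s t := by ext x; exact smul_add (f x) (s x) (t x)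
  add_smul f g s := by ext x; exact add_smul (f x) (g x) (s x)
  zero_smul s := by ext x; exact zero_smul ℝ (s x)

instance smoothSectionsTower : IsScalarTower ℝ C^∞⟮𝓡 d, M; ℝ⟯ Cₛ^∞⟮𝓡 d; F, E⟯ where
  smul_assoc r f s := by ext x; exact smul_assoc r (f x) (s x)

variable [IsManifold (𝓡 d) ∞ M]

/-- The derivative `X(f)` of a smooth function along a smooth vector field. -/
def smoothDeriv (X : Cₛ^∞⟮𝓡 d; EuclideanSpace ℝ (Fin d), (TangentSpace (𝓡 d) : M → Type _)⟯)
    (f : C^∞⟮𝓡 d, M; ℝ⟯) : C^∞⟮𝓡 d, M; ℝ⟯ where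
  val x := mvfderiv (𝓡 d) f x (X x)
  property := by
    have h := (f.contMDiff.contMDiff_tangentMap (m := ∞) le_rfl).comp X.contMDiff
    exact (contMDiff_snd_tangentBundle_modelSpace ℝ 𝓘(ℝ, ℝ)).comp h

section Anchor

variable (ρ : Cₛ^∞⟮𝓡 d; F →L[ℝ] EuclideanSpace ℝ (Fin d),
    fun x : M => E x →L[ℝ] TangentSpace (𝓡 d) x⟯)

/-- The vector field `ρ(a)`. -/
def applyAnchor (a : Cₛ^∞⟮𝓡 d; F, E⟯) :
    Cₛ^∞⟮𝓡 d; EuclideanSpace ℝ (Fin d), (TangentSpace (𝓡 d) : M → Type _)⟯ where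
  toFun x := ρ x (a x)
  contMDiff_toFun := ContMDiff.clm_bundle_apply ρ.contMDiff a.contMDiff

/-- The function `ρ(a)(f)`. -/
def anchorDeriv (a : Cₛ^∞⟮𝓡 d; F, E⟯) (f : C^∞⟮𝓡 d, M; ℝ⟯) : C^∞⟮𝓡 d, M; ℝ⟯ :=
  smoothDeriv (applyAnchor ρ a) f

lemma anchorDeriv_apply (a : Cₛ^∞⟮𝓡 d; F, E⟯) (f : C^∞⟮𝓡 d, M; ℝ⟯) (x : M) :
    anchorDeriv ρ a f x = mvfderiv (𝓡 d) f x (ρ x (a x)) := rfl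

end Anchor

variable (d F E) in
/-- A Lie algebroid structure on the smooth vector bundle `E → M`: a smooth bundle map
`ρ : E → TM` over the identity, the anchor, and a Lie bracket on `Γ(E)` with
`[a, f b] = f [a, b] + ρ(a)(f) b`. (That `ρ` preserves brackets is listed for convenience; it
follows from the Jacobi and Leibniz identities.) -/
class LieAlgebroid where
  anchor : Cₛ^∞⟮𝓡 d; F →L[ℝ] EuclideanSpace ℝ (Fin d),
    fun x : M => E x →L[ℝ] TangentSpace (𝓡 d) x⟯
  bracket : Cₛ^∞⟮𝓡 d; F, E⟯ → Cₛ^∞⟮𝓡 d; F, E⟯ → Cₛ^∞⟮𝓡 d; F, E⟯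
  bracket_add : ∀ a b c, bracket a (b + c) = bracket a b + bracket a c
  add_bracket : ∀ a b c, bracket (a + b) c = bracket a c + bracket b c
  bracket_self : ∀ a, bracket a a = 0
  jacobi : ∀ a b c, bracket a (bracket b c) = bracket (bracket a b) c + bracket b (bracket a c)
  leibniz : ∀ a (f : C^∞⟮𝓡 d, M; ℝ⟯) b,
    bracket a (f • b) = f • bracket a b + anchorDeriv anchor a f • b
  anchor_bracket : ∀ a b (f : C^∞⟮𝓡 d, M; ℝ⟯), anchorDeriv anchor (bracket a b) f =
    anchorDeriv anchor a (anchorDeriv anchor b f) - anchorDeriv anchor b (anchorDeriv anchor a f)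

section Instances
variable [LieAlgebroid d F E]

instance : LieRing Cₛ^∞⟮𝓡 d; F, E⟯ :=
  { (inferInstance : AddCommGroup Cₛ^∞⟮𝓡 d; F, E⟯) with
    bracket := LieAlgebroid.bracket
    add_lie := LieAlgebroid.add_bracket
    lie_add := LieAlgebroid.bracket_add
    lie_self := LieAlgebroid.bracket_self
    leibniz_lie := LieAlgebroid.jacobi }

lemma mvfderiv_add_smooth (f g : C^∞⟮𝓡 d, M; ℝ⟯) (x : M) :
    mvfderiv (𝓡 d) (f + g : C^∞⟮𝓡 d, M; ℝ⟯) x = mvfderiv (𝓡 d) f x + mvfderiv (𝓡 d) g x :=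
  mvfderiv_add f.mdifferentiableAt g.mdifferentiableAt

lemma mvfderiv_mul_smooth (f g : C^∞⟮𝓡 d, M; ℝ⟯) (x : M) :
    mvfderiv (𝓡 d) (f * g : C^∞⟮𝓡 d, M; ℝ⟯) x =
      f x • mvfderiv (𝓡 d) g x + g x • mvfderiv (𝓡 d) f x :=
  mvfderiv_mul f.mdifferentiableAt g.mdifferentiableAt

/-- The action of `Γ(E)` on functions, `⁅a, f⁆ = ρ(a)(f)`. -/
instance : LieRingModule Cₛ^∞⟮𝓡 d; F, E⟯ C^∞⟮𝓡 d, M; ℝ⟯ where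
  bracket a f := anchorDeriv (LieAlgebroid.anchor (d := d) (F := F) (E := E)) a f
  add_lie a b f := by
    ext x
    change mvfderiv (𝓡 d) f x (LieAlgebroid.anchor (d := d) (F := F) (E := E) x (a x + b x)) = _
    rw [map_add, map_add]; rfl
  lie_add a f g := by
    ext x
    change mvfderiv (𝓡 d) (f + g : C^∞⟮𝓡 d, M; ℝ⟯) x _ = _
    rw [mvfderiv_add_smooth]; rfl
  leibniz_lie a b f := by
    change anchorDeriv _ _ (anchorDeriv _ _ f) = anchorDeriv _ _ f + anchorDeriv _ _ (anchorDeriv _ _ f)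
    have h := LieAlgebroid.anchor_bracket a b f
    exact (sub_eq_iff_eq_add.1 h.symm)

lemma lie_smoothFunction_apply (a : Cₛ^∞⟮𝓡 d; F, E⟯) (f : C^∞⟮𝓡 d, M; ℝ⟯) (x : M) :
    ⁅a, f⁆ x = mvfderiv (𝓡 d) f x (LieAlgebroid.anchor (d := d) (F := F) (E := E) x (a x)) := rfl

instance : LieRinehartRing C^∞⟮𝓡 d, M; ℝ⟯ Cₛ^∞⟮𝓡 d; F, E⟯ where
  lie_smul_eq_mul' f g a := by
    ext x
    change mvfderiv (𝓡 d) g x (LieAlgebroid.anchor (d := d) (F := F) (E := E) x (f x • a x)) = _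
    rw [map_smul, map_smul]; rfl
  leibniz_mul_right' a f g := by
    ext x
    change mvfderiv (𝓡 d) (f * g : C^∞⟮𝓡 d, M; ℝ⟯) x _ = f x * ⁅a, g⁆ x + ⁅a, f⁆ x * g x
    rw [mvfderiv_mul_smooth, mul_comm (⁅a, f⁆ x)]; rfl
  leibniz_smul_right' a b f := LieAlgebroid.leibniz a f b

lemma lie_const_smooth (a : Cₛ^∞⟮𝓡 d; F, E⟯) (r : ℝ) :
    ⁅a, algebraMap ℝ C^∞⟮𝓡 d, M; ℝ⟯ r⁆ = 0 := by
  ext x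
  change mvfderiv (𝓡 d) (fun _ : M => r) x _ = 0
  rw [mvfderiv_const]; rfl

instance : LieAlgebra ℝ Cₛ^∞⟮𝓡 d; F, E⟯ where
  lie_smul r a b := by
    rw [← algebraMap_smul C^∞⟮𝓡 d, M; ℝ⟯ r b, LieRinehartRing.leibniz_smul_right,
      lie_const_smooth, zero_smul, add_zero, algebraMap_smul]

instance : LieRinehartAlgebra ℝ C^∞⟮𝓡 d, M; ℝ⟯ Cₛ^∞⟮𝓡 d; F, E⟯ where
  smul_lie r a f := by
    rw [← algebraMap_smul C^∞⟮𝓡 d, M; ℝ⟯ r a, LieRinehartRing.lie_smul_eq_mul,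
      ← smul_eq_mul, algebraMap_smul]
  lie_smul r a f := by
    rw [Algebra.smul_def, LieRinehartRing.leibniz_mul_right, lie_const_smooth, zero_mul, add_zero,
      smul_eq_mul, ← Algebra.smul_def]

variable (d F E) in
/-- A Lie subalgebroid of rank `r` of the Lie algebroid `E` over the same base: a smooth subbundle
of rank `r` (near each point it is framed by `r` smooth sections) whose sections are closed under
the bracket. -/
structure LieSubalgebroid (r : ℕ) where
  fiber : (x : M) → Submodule ℝ (E x)
  exists_frame : ∀ x, ∃ s : Fin r → Cₛ^∞⟮𝓡 d; F, E⟯, ∀ᶠ y in 𝓝 x,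
    LinearIndependent ℝ (fun i => s i y) ∧ Submodule.span ℝ (Set.range fun i => s i y) = fiber y
  lie_mem : ∀ a b : Cₛ^∞⟮𝓡 d; F, E⟯, (∀ x, a x ∈ fiber x) → (∀ x, b x ∈ fiber x) →
    ∀ x, ⁅a, b⁆ x ∈ fiber x

/-- The module `Γ(B)` of sections of `E` with values in the subalgebroid `B`. -/
def LieSubalgebroid.sections {r : ℕ} (B : LieSubalgebroid d F E r) :
    LieRinehartSubalgebra C^∞⟮𝓡 d, M; ℝ⟯ Cₛ^∞⟮𝓡 d; F, E⟯ where
  carrier := {a | ∀ x, a x ∈ B.fiber x}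
  add_mem' ha hb x := (B.fiber x).add_mem (ha x) (hb x)
  zero_mem' x := (B.fiber x).zero_mem
  smul_mem' f _ ha x := (B.fiber x).smul_mem (f x) (ha x)
  lie_mem' ha hb := B.lie_mem _ _ ha hb

end Instances

section Trace

variable [FiniteDimensional ℝ F] [ContMDiffVectorBundle ∞ F E (𝓡 d)] [T2Space M]

/-- Global smooth sections that restrict to a local frame near `x`. -/
lemma exists_cutoff_frame (x : M) :
    ∃ (χ : C^∞⟮𝓡 d, M; ℝ⟯) (S : Fin (Module.finrank ℝ F) → Cₛ^∞⟮𝓡 d; F, E⟯),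
      (∀ᶠ y in 𝓝 x, χ y = 1) ∧ (∀ y, y ∉ (trivializationAt F E x).baseSet → χ =ᶠ[𝓝 y] 0) ∧
      ∀ i y, S i y = χ y • (trivializationAt F E x).localFrame (Module.finBasis ℝ F) i y := by
  set e := trivializationAt F E x
  have hx : e.baseSet ∈ 𝓝 x := e.open_baseSet.mem_nhds (mem_baseSet_trivializationAt F E x)
  obtain ⟨χ, -, hχ⟩ := (SmoothBumpFunction.nhds_basis_tsupport (I := 𝓡 d) x).mem_iff.1 hx
  refine ⟨⟨χ, χ.contMDiff⟩, fun i => ⟨fun y => χ y • e.localFrame (Module.finBasis ℝ F) i y, ?_⟩,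
    χ.eventuallyEq_one, ?_, fun i y => rfl⟩
  · exact ContMDiffOn.smul_section_of_tsupport χ.contMDiff.contMDiffOn e.open_baseSet hχ
      (e.contMDiffOn_localFrame_baseSet ∞ _ i)
  · intro y hy
    exact notMem_tsupport_iff_eventuallyEq.1 fun h => hy (hχ h)

/-- `(φ s)(x)` only depends on `s x`. -/
lemma end_apply_eq_zero (φ : Module.End C^∞⟮𝓡 d, M; ℝ⟯ Cₛ^∞⟮𝓡 d; F, E⟯)
    (s : Cₛ^∞⟮𝓡 d; F, E⟯) (x : M) (hs : s x = 0) : φ s x = 0 := by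
  obtain ⟨χ, S, h1, h0, hS⟩ := exists_cutoff_frame (d := d) (F := F) (E := E) x
  set e := trivializationAt F E x
  set b := Module.finBasis ℝ F
  have : ContMDiffVectorBundle 1 F E (𝓡 d) := ContMDiffVectorBundle.of_le (n := ∞) (by simp)
  let g : Fin (Module.finrank ℝ F) → C^∞⟮𝓡 d, M; ℝ⟯ := fun i =>
    ⟨fun y => χ y * e.localFrameCoeff (𝓡 d) b i y (s y), by
      intro y
      by_cases hy : y ∈ e.baseSet
      · exact χ.contMDiff.contMDiffAt.mul (contMDiffAt_localFrameCoeff b hy s.contMDiff.contMDiffAt i)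
      · refine (contMDiffAt_const (c := (0 : ℝ))).congr_of_eventuallyEq ?_
        filter_upwards [h0 y hy] with z hz
        simp [hz]⟩
  have hsum : (χ * χ) • s = ∑ i, g i • S i := by
    ext y
    have : (∑ i, g i • S i) y = ∑ i, (g i • S i) y := by
      have := map_sum (ContMDiffSection.coeAddHom (𝓡 d) F ∞ E) (fun i => g i • S i) Finset.univ
      exact (congrFun this y).trans (Finset.sum_apply _ _ _)
    rw [this]
    simp only [smoothSections_smul_apply, hS]
    by_cases hy : y ∈ e.baseSet
    · conv_lhs => rw [e.eq_sum_localFrameCoeff_smul (I := 𝓡 d) (b := b) (s := s) hy]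
      rw [Finset.smul_sum]
      refine Finset.sum_congr rfl fun i _ => ?_
      change (χ y * χ y) • _ = (χ y * _) • _
      simp only [smul_smul]
      congr 1; ring
    · have : χ y = 0 := (h0 y hy).eq_of_nhds
      change (χ y * χ y) • _ = _
      simp [this]
  have h2 := congrArg (fun t => φ t x) hsum
  simp only [map_smul, map_sum] at h2
  have : (∑ i, g i • φ (S i)) x = ∑ i, (g i • φ (S i)) x := by
    have := map_sum (ContMDiffSection.coeAddHom (𝓡 d) F ∞ E) (fun i => g i • φ (S i)) Finset.univ
    exact (congrFun this x).trans (Finset.sum_apply _ _ _)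
  rw [this] at h2
  have hx1 : χ x = 1 := h1.self_of_nhds
  have hg : ∀ i, g i x = 0 := fun i => by
    change χ x * e.localFrameCoeff (𝓡 d) b i x (s x) = 0
    rw [hs, map_zero, mul_zero]
  simp only [smoothSections_smul_apply, hg, zero_smul, Finset.sum_const_zero] at h2
  change (χ x * χ x) • _ = _ at h2
  simpa [hx1] using h2

lemma end_apply_congr (φ : Module.End C^∞⟮𝓡 d, M; ℝ⟯ Cₛ^∞⟮𝓡 d; F, E⟯)
    {s t : Cₛ^∞⟮𝓡 d; F, E⟯} {x : M} (h : s x = t x) : φ s x = φ t x := by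
  have := end_apply_eq_zero φ (s - t) x (by simp [h])
  rw [map_sub] at this
  exact sub_eq_zero.1 this

lemma exists_section_eq (x : M) (v : E x) : ∃ s : Cₛ^∞⟮𝓡 d; F, E⟯, s x = v := by
  obtain ⟨χ, S, h1, h0, hS⟩ := exists_cutoff_frame (d := d) (F := F) (E := E) x
  have hx := mem_baseSet_trivializationAt F E x
  set e := trivializationAt F E x
  set b := Module.finBasis ℝ F
  refine ⟨∑ i, (e.basisAt b hx).repr v i • S i, ?_⟩
  have := map_sum (ContMDiffSection.coeAddHom (𝓡 d) F ∞ E)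
    (fun i => (e.basisAt b hx).repr v i • S i) Finset.univ
  refine ((congrFun this x).trans (Finset.sum_apply _ _ _)).trans ?_
  refine Eq.trans (Finset.sum_congr rfl fun i _ => ?_) ((e.basisAt b hx).sum_repr v)
  change (e.basisAt b hx).repr v i • S i x = _
  rw [hS, h1.self_of_nhds, one_smul, e.localFrame_apply_of_mem_baseSet b hx]

/-- The endomorphism of the fibre `E x` induced by `φ ∈ End Γ(E) = Γ(End E)`; see
`endFiber_apply`. -/
def endFiber (φ : Module.End C^∞⟮𝓡 d, M; ℝ⟯ Cₛ^∞⟮𝓡 d; F, E⟯) (x : M) : E x →ₗ[ℝ] E x where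
  toFun v := φ (exists_section_eq (d := d) (F := F) x v).choose x
  map_add' v w := by
    rw [end_apply_congr φ (t := (exists_section_eq (d := d) (F := F) x v).choose +
      (exists_section_eq (d := d) (F := F) x w).choose), map_add]
    · rfl
    · rw [(exists_section_eq x (v + w)).choose_spec]
      change _ = (exists_section_eq (d := d) (F := F) x v).choose x +
        (exists_section_eq (d := d) (F := F) x w).choose x
      rw [(exists_section_eq x v).choose_spec, (exists_section_eq x w).choose_spec]
  map_smul' r v := by
    rw [end_apply_congr φ (t := algebraMap ℝ C^∞⟮𝓡 d, M; ℝ⟯ r •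
      (exists_section_eq (d := d) (F := F) x v).choose), map_smul]
    · rfl
    · rw [(exists_section_eq x (r • v)).choose_spec]
      change _ = r • (exists_section_eq (d := d) (F := F) x v).choose x
      rw [(exists_section_eq x v).choose_spec]

lemma endFiber_apply (φ : Module.End C^∞⟮𝓡 d, M; ℝ⟯ Cₛ^∞⟮𝓡 d; F, E⟯) (s : Cₛ^∞⟮𝓡 d; F, E⟯)
    (x : M) : endFiber φ x (s x) = φ s x :=
  end_apply_congr φ (exists_section_eq x (s x)).choose_spec

lemma contMDiff_trace_endFiber (φ : Module.End C^∞⟮𝓡 d, M; ℝ⟯ Cₛ^∞⟮𝓡 d; F, E⟯) :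
    ContMDiff (𝓡 d) 𝓘(ℝ, ℝ) ∞ fun x => LinearMap.trace ℝ (E x) (endFiber φ x) := by
  intro x
  obtain ⟨χ, S, h1, h0, hS⟩ := exists_cutoff_frame (d := d) (F := F) (E := E) x
  have hx := mem_baseSet_trivializationAt F E x
  set e := trivializationAt F E x
  set b := Module.finBasis ℝ F
  have : ContMDiffVectorBundle 1 F E (𝓡 d) := ContMDiffVectorBundle.of_le (n := ∞) (by simp)
  have hsm : ContMDiffAt (𝓡 d) 𝓘(ℝ, ℝ) ∞
      (fun y => ∑ i, e.localFrameCoeff (𝓡 d) b i y (φ (S i) y)) x :=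
    contMDiffAt_finsetSum fun i _ =>
      contMDiffAt_localFrameCoeff b hx (φ (S i)).contMDiff.contMDiffAt i
  refine hsm.congr_of_eventuallyEq ?_
  filter_upwards [h1, e.open_baseSet.mem_nhds hx] with y hy1 hy
  rw [LinearMap.trace_eq_matrix_trace ℝ (e.basisAt b hy), Matrix.trace]
  refine Finset.sum_congr rfl fun i _ => ?_
  have hSi : S i y = e.basisAt b hy i := by
    rw [hS, hy1, one_smul, e.localFrame_apply_of_mem_baseSet b hy]
  rw [Matrix.diag_apply, LinearMap.toMatrix_apply, ← hSi, endFiber_apply,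
    e.localFrameCoeff_apply_of_mem_baseSet b hy (fun y => φ (S i) y)]

variable (d F E) in
/-- The fibrewise trace `tr : Γ(End E) → C^∞(M)`. -/
def fiberTrace : Module.End C^∞⟮𝓡 d, M; ℝ⟯ Cₛ^∞⟮𝓡 d; F, E⟯ →ₗ[C^∞⟮𝓡 d, M; ℝ⟯] C^∞⟮𝓡 d, M; ℝ⟯ where
  toFun φ := ⟨fun x => LinearMap.trace ℝ (E x) (endFiber φ x), contMDiff_trace_endFiber φ⟩
  map_add' φ ψ := by
    ext x
    change LinearMap.trace ℝ (E x) (endFiber (φ + ψ) x) =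
      LinearMap.trace ℝ (E x) (endFiber φ x) + LinearMap.trace ℝ (E x) (endFiber ψ x)
    rw [← map_add]; rfl
  map_smul' f φ := by
    ext x
    change LinearMap.trace ℝ (E x) (endFiber (f • φ) x) =
      f x • LinearMap.trace ℝ (E x) (endFiber φ x)
    rw [← map_smul]; rfl

end Trace
end Manifold

end LieRinehart

end

noncomputable section

namespace LieRinehart

/-! Let `φ ∈ Γ(Hom(A/B, End E))` be a primitive of the Atiyah form `ω` of an extension of `∇`.
Subtracting `φ ∘ pr` from that extension gives another extension, because `φ ∘ pr` kills `B`. Its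
curvature on `(b, a)` is `ω(b, ā) - (∇_b φ)(ā) = 0`; no quadratic term appears, again because `φ ∘
pr` kills `B`. So `∇` extends to an `A`-connection whose curvature is annihilated by contraction
with `B` (`exists_vanishesOn_curvature`). Products and traces keep this property
(`IsPontryaginForm.vanishesOn`): the Pontryagin forms of this connection are pointwise elements of
`∧^l (A/B)^*`, which is zero for `l > q = rank A/B` (`LieSubalgebroid.eq_zero_of_vanishesOn`).

Since `pontryaginSpace` admits all connections, independence of the connection is needed as well
(`characterForm_sub_mem_exactForms`, `IsPontryaginForm.exists_sub_mem_exactForms`). With `η = ∇¹ -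
∇⁰`, `R` the curvature of `∇⁰` and `F = dη`, the curvature of `∇⁰ + X η` is the polynomial `P = R +
X F + X² η²`. Bianchi gives `dP = X [P, η]`, and cyclicity of the trace gives `d/dX tr(P^(n+1)) =
(n+1) d tr(η P^n)`. Comparing coefficients, every coefficient of `tr(P^(n+1))` except the constant
one is exact, after division by an integer. The constant one is `tr(R^(n+1))`, and the sum of all of
them is the value at `X = 1`, the form of `∇¹`. This replaces the usual integral over `[0, 1]`.

The algebra takes place in `ListForm`, a ring of all functions on lists with the shuffle product.
Forms of all degrees share one type, and an identity is checked by contracting with one vector and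
inducting on the list. `ofAlt` embeds alternating maps and carries `wedge` to the product and
`koszul` to `d` (`ofAlt_wedge`, `d_ofAlt_ofFn`).

Geometry enters in three places: the trace is cyclic and parallel (`fiberTrace_mul_comm`,
`fiberTrace_hom`), forms are pointwise (`functional_apply_eq_zero`), and extensions of `∇` exist by
a partition of unity (`LieSubalgebroid.nonempty_extension`), so that `atiyahClass` is not its
default value. -/

/-- Functions on lists, thought of as inhomogeneous forms (not necessarily alternating). -/
structure ListForm (L S : Type*) where
  toFun : List L → S

/-! ### Inhomogeneous forms and the shuffle product. -/

namespace ListForm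

variable {L S : Type*}

instance : FunLike (ListForm L S) (List L) S where
  coe := toFun
  coe_injective := fun ⟨_⟩ ⟨_⟩ h => congrArg mk h

@[ext] lemma ext {f g : ListForm L S} (h : ∀ l, f l = g l) : f = g := DFunLike.ext f g h
@[simp] lemma mk_apply (f : List L → S) (l) : (⟨f⟩ : ListForm L S) l = f l := rfl

section AddCommGroup
variable [AddCommGroup S]

instance : Zero (ListForm L S) := ⟨⟨0⟩⟩
instance : Add (ListForm L S) := ⟨fun f g => ⟨f + g⟩⟩
instance : Neg (ListForm L S) := ⟨fun f => ⟨-f⟩⟩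
instance : Sub (ListForm L S) := ⟨fun f g => ⟨f - g⟩⟩
instance {R : Type*} [SMul R S] : SMul R (ListForm L S) :=
  ⟨fun r f => ⟨r • ⇑f⟩⟩

instance : AddCommGroup (ListForm L S) :=
  DFunLike.coe_injective.addCommGroup _ rfl (fun _ _ => rfl) (fun _ => rfl) (fun _ _ => rfl)
    (fun _ _ => rfl) (fun _ _ => rfl)

@[simp] lemma add_apply (f g : ListForm L S) (l) : (f + g) l = f l + g l := rfl
@[simp] lemma sub_apply (f g : ListForm L S) (l) : (f - g) l = f l - g l := rfl
@[simp] lemma neg_apply (f : ListForm L S) (l) : (-f) l = -f l := rfl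
@[simp] lemma zero_apply (l) : (0 : ListForm L S) l = 0 := rfl

/-- The interior product. -/
def ι (a : L) : ListForm L S →+ ListForm L S where
  toFun f := ⟨fun l => f (a :: l)⟩
  map_zero' := rfl
  map_add' _ _ := rfl

lemma ι_apply (a : L) (f : ListForm L S) (l) : ι a f l = f (a :: l) := rfl
@[simp] lemma apply_cons (f : ListForm L S) (a : L) (l) : f (a :: l) = ι a f l := rfl

/-- The induction principle behind the calculus: a form is determined by its degree zero part and
its contractions, so an identity between operators needs only their commutation rules with `ι a`. -/
lemma ext_ι {f g : ListForm L S} (h0 : f [] = g []) (h : ∀ a, ι a f = ι a g) : f = g := by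
  ext l
  cases l with
  | nil => exact h0
  | cons a l => exact DFunLike.congr_fun (h a) l

/-- The grading involution. -/
def ε : ListForm L S →+ ListForm L S where
  toFun f := ⟨fun l => (-1 : ℤ) ^ l.length • f l⟩
  map_zero' := by ext l; exact smul_zero _
  map_add' _ _ := by ext l; exact smul_add _ _ _

lemma ε_apply (f : ListForm L S) (l) : ε f l = (-1 : ℤ) ^ l.length • f l := rfl
@[simp] lemma ε_nil (f : ListForm L S) : ε f [] = f [] := by simp [ε_apply]
@[simp] lemma ι_ε (a : L) (f : ListForm L S) : ι a (ε f) = -ε (ι a f) := by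
  ext l; simp [ε_apply, ι_apply, pow_succ, -apply_cons]
@[simp] lemma ε_ε (f : ListForm L S) : ε (ε f) = f := by
  ext l; simp [ε_apply, smul_smul, ← mul_pow]

end AddCommGroup

section Ring
variable [Ring S]

/-- The signed shuffle product. -/
def mulAux : List L → ListForm L S → ListForm L S → S
  | [], f, g => f [] * g []
  | a :: l, f, g => mulAux l (ι a f) g + mulAux l (ε f) (ι a g)

instance : Mul (ListForm L S) := ⟨fun f g => ⟨fun l => mulAux l f g⟩⟩
instance : One (ListForm L S) := ⟨⟨fun l => if l = [] then 1 else 0⟩⟩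

@[simp] lemma mul_nil (f g : ListForm L S) : (f * g) [] = f [] * g [] := rfl
@[simp] lemma one_nil : (1 : ListForm L S) [] = 1 :=
  if_pos (t := (1 : S)) (e := 0) (rfl : ([] : List L) = [])
@[simp] lemma ι_one (a : L) : ι a (1 : ListForm L S) = 0 :=
  ext fun l => if_neg (t := (1 : S)) (c := a :: l = []) (List.cons_ne_nil a l)

@[simp] lemma ι_mul (a : L) (f g : ListForm L S) : ι a (f * g) = ι a f * g + ε f * ι a g := rfl

/-- The forms are quantified after the list because the inductive step replaces them by `ι a f` and
`ε f`. The later `_apply` lemmas have the same shape. -/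
lemma add_mul_apply (l : List L) : ∀ f g h : ListForm L S, ((f + g) * h) l = (f * h) l + (g * h) l := by
  induction l with
  | nil => intro f g h; simp [add_mul]
  | cons a l ih => intro f g h; simp [ih]; abel

lemma mul_add_apply (l : List L) : ∀ f g h : ListForm L S, (f * (g + h)) l = (f * g) l + (f * h) l := by
  induction l with
  | nil => intro f g h; simp [mul_add]
  | cons a l ih => intro f g h; simp [ih]; abel

instance : NonUnitalNonAssocRing (ListForm L S) where
  left_distrib f g h := ext fun l => mul_add_apply l f g h
  right_distrib f g h := ext fun l => add_mul_apply l f g h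
  zero_mul g := by
    have : (0 + 0) * g = 0 * g + 0 * g := ext fun l => add_mul_apply l 0 0 g
    rw [add_zero] at this
    exact left_eq_add.1 this
  mul_zero g := by
    have : g * (0 + 0) = g * 0 + g * 0 := ext fun l => mul_add_apply l g 0 0
    rw [add_zero] at this
    exact left_eq_add.1 this

lemma ε_mul_apply (l : List L) : ∀ f g : ListForm L S, (ε (f * g)) l = (ε f * ε g) l := by
  induction l with
  | nil => intro f g; simp
  | cons a l ih => intro f g; simp [ih, add_comm]

@[simp] lemma ε_mul (f g : ListForm L S) : ε (f * g) = ε f * ε g := ext fun l => ε_mul_apply l f g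

@[simp] lemma ε_one : ε (1 : ListForm L S) = 1 := by
  refine ext_ι (by simp) fun a => by simp

/-- `ι a` is an antiderivation and `ε` is multiplicative, so contracting either side gives the same
three terms, to which induction applies. -/
lemma mul_assoc_apply (l : List L) :
    ∀ f g h : ListForm L S, (f * g * h) l = (f * (g * h)) l := by
  induction l with
  | nil => intro f g h; simp [mul_assoc]
  | cons a l ih =>
    intro f g h
    rw [apply_cons, apply_cons]
    simp [add_mul, mul_add, ih, add_assoc]

lemma one_mul_apply (l : List L) : ∀ f : ListForm L S, (1 * f) l = f l := by
  induction l with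
  | nil => intro f; simp
  | cons a l ih => intro f; rw [apply_cons, apply_cons]; simp [ih]

lemma mul_one_apply (l : List L) : ∀ f : ListForm L S, (f * 1) l = f l := by
  induction l with
  | nil => intro f; simp
  | cons a l ih => intro f; rw [apply_cons, apply_cons]; simp [ih]

instance : Ring (ListForm L S) :=
  { (inferInstance : AddCommGroup (ListForm L S)),
    (inferInstance : NonUnitalNonAssocRing (ListForm L S)) with
    mul_assoc := fun f g h => ext fun l => mul_assoc_apply l f g h
    one := 1
    one_mul := fun f => ext fun l => one_mul_apply l f
    mul_one := fun f => ext fun l => mul_one_apply l f }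

end Ring

section Map
variable {S' : Type*} [AddCommGroup S] [AddCommGroup S']

/-- Composition with an additive map. -/
def map (τ : S →+ S') : ListForm L S →+ ListForm L S' where
  toFun f := ⟨fun l => τ (f l)⟩
  map_zero' := by ext l; exact map_zero τ
  map_add' _ _ := by ext l; exact map_add τ _ _

@[simp] lemma map_apply (τ : S →+ S') (f : ListForm L S) (l) : map τ f l = τ (f l) := rfl
@[simp] lemma ι_map (τ : S →+ S') (f : ListForm L S) (a) : ι a (map τ f) = map τ (ι a f) := rfl

end Map

/-! ### Graded cyclicity of a trace. -/

section Trace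
variable {S' : Type*} [Ring S] [AddCommGroup S'] (τ : S →+ S') (hτ : ∀ x y, τ (x * y) = τ (y * x))
include hτ

/-- Contraction changes the parity of `f`, so the even and the odd case need each other in the
induction. In the odd case `ε g` carries the sign `(-1)^|g|` for all degrees of `g` at once.
Cyclicity of `τ` on values enters at the empty list. -/
lemma map_mul_comm_apply (l : List L) : ∀ f g : ListForm L S,
    (ε f = f → map τ (f * g) l = map τ (g * f) l) ∧
    (ε f = -f → map τ (f * g) l = map τ (ε g * f) l) := by
  induction l with
  | nil => intro f g; simp [hτ]
  | cons a l ih =>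
    intro f g
    constructor <;> intro hf
    · have hι : ε (ι a f) = -ι a f := by rw [← neg_eq_iff_eq_neg, ← ι_ε, hf]
      rw [apply_cons, apply_cons]
      simp only [ι_map, ι_mul, map_add, add_apply, hf]
      rw [(ih _ _).2 hι, (ih f _).1 hf, add_comm]
    · have hι : ε (ι a f) = ι a f := by
        rw [← neg_inj, ← ι_ε, hf, map_neg]
      rw [apply_cons, apply_cons]
      simp only [ι_map, ι_mul, map_add, add_apply, hf, ε_ε, ι_ε, neg_mul, map_neg, neg_apply]
      rw [(ih _ _).1 hι, (ih f _).2 hf, add_comm]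

lemma map_mul_comm_of_even {f : ListForm L S} (hf : ε f = f) (g : ListForm L S) :
    map τ (f * g) = map τ (g * f) := ext fun l => (map_mul_comm_apply τ hτ l f g).1 hf

lemma map_mul_comm_of_odd {f : ListForm L S} (hf : ε f = -f) (g : ListForm L S) :
    map τ (f * g) = map τ (ε g * f) := ext fun l => (map_mul_comm_apply τ hτ l f g).2 hf

end Trace

/-! ### Forms annihilated by contraction with `B`. -/

section Vanish

/-- The forms that vanish as soon as one argument lies in `B`. -/
def VanishesOn [Zero S] (B : Set L) (f : ListForm L S) : Prop := ∀ l, (∃ b ∈ l, b ∈ B) → f l = 0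

lemma VanishesOn.ε [AddCommGroup S] {B : Set L} {f : ListForm L S} (hf : VanishesOn B f) :
    VanishesOn B (ε f) := fun l hl => by rw [ε_apply, hf l hl, smul_zero]

lemma VanishesOn.ι [AddCommGroup S] {B : Set L} {f : ListForm L S} (hf : VanishesOn B f) (a : L) :
    VanishesOn B (ι a f) := fun _ ⟨b, hb, h⟩ => hf _ ⟨b, List.mem_cons_of_mem _ hb, h⟩

lemma VanishesOn.ι_eq_zero [AddCommGroup S] {B : Set L} {f : ListForm L S} (hf : VanishesOn B f)
    {b : L} (hb : b ∈ B) : ListForm.ι b f = 0 := ext fun _ => hf _ ⟨b, List.mem_cons_self, hb⟩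

/-- If the first entry lies in `B`, both contractions in the product rule are zero; otherwise the
entry from `B` is in the tail, and contracted factors still vanish on `B`. -/
lemma vanishesOn_mul_apply [Ring S] {B : Set L} (l : List L) (hl : ∃ b ∈ l, b ∈ B) :
    ∀ f g : ListForm L S, VanishesOn B f → VanishesOn B g → (f * g) l = 0 := by
  induction l with
  | nil => simp at hl
  | cons a l ih =>
    intro f g hf hg
    rw [apply_cons, ι_mul, add_apply]
    by_cases ha : a ∈ B
    · rw [hf.ι_eq_zero ha, hg.ι_eq_zero ha, zero_mul, mul_zero, zero_apply, add_zero]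
    · have hl' : ∃ b ∈ l, b ∈ B := by
        obtain ⟨b, hb, hB⟩ := hl
        rcases List.mem_cons.1 hb with rfl | hb
        · exact absurd hB ha
        · exact ⟨b, hb, hB⟩
      rw [ih hl' _ _ (hf.ι a) hg, ih hl' _ _ hf.ε (hg.ι a), add_zero]

lemma VanishesOn.mul [Ring S] {B : Set L} {f g : ListForm L S} (hf : VanishesOn B f)
    (hg : VanishesOn B g) : VanishesOn B (f * g) := fun l hl => vanishesOn_mul_apply l hl f g hf hg

lemma vanishesOn_one [Ring S] {B : Set L} : VanishesOn B (1 : ListForm L S) := by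
  rintro (_ | ⟨a, l⟩) hl
  · simp at hl
  · simp

lemma VanishesOn.pow [Ring S] {B : Set L} {f : ListForm L S} (hf : VanishesOn B f) (n : ℕ) :
    VanishesOn B (f ^ n) := by
  induction n with
  | zero => rw [pow_zero]; exact vanishesOn_one
  | succ n ih => rw [pow_succ]; exact ih.mul hf

end Vanish

/-! ### Lie derivative and differential by Cartan calculus. -/

section Differential
variable {N : Type*} [LieRing L] [AddCommGroup N]

/-- `∑ j, f(l_1, …, [a, l_j], …, l_k)`. -/
def adSum (a : L) : List L → ListForm L N → N
  | [], _ => 0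
  | b :: l, f => f (⁅a, b⁆ :: l) + adSum a l (ι b f)

lemma adSum_add (a : L) (l : List L) : ∀ f g : ListForm L N,
    adSum a l (f + g) = adSum a l f + adSum a l g := by
  induction l with
  | nil => intro f g; simp [adSum]
  | cons b l ih => intro f g; simp only [adSum, map_add, ih, add_apply]; abel

/-- The Lie derivative along `a` defined by an additive operator `T` on the values. -/
def lieD (T : N →+ N) (a : L) : ListForm L N →+ ListForm L N where
  toFun f := ⟨fun l => T (f l) - adSum a l f⟩
  map_zero' := by
    ext l
    have := adSum_add a l (0 : ListForm L N) 0
    simp only [add_zero, left_eq_add] at this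
    simp [this]
  map_add' f g := by
    ext l
    simp only [adSum_add, add_apply, map_add, mk_apply]
    abel

lemma lieD_apply (T : N →+ N) (a : L) (f : ListForm L N) (l) :
    lieD T a f l = T (f l) - adSum a l f := rfl

@[simp] lemma lieD_nil (T : N →+ N) (a : L) (f : ListForm L N) : lieD T a f [] = T (f []) := by
  simp [lieD_apply, adSum]

/-- Cartan's relation `[L_a, ι_b] = ι_[a,b]`: the extra term is the summand of `adSum` that brackets
the first entry. -/
lemma ι_lieD (T : N →+ N) (a b : L) (f : ListForm L N) :
    ι b (lieD T a f) = lieD T a (ι b f) - ι ⁅a, b⁆ f := by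
  ext l; simp only [ι_apply, lieD_apply, adSum, sub_apply]; abel

lemma lieD_ε (T : N →+ N) (a : L) (f : ListForm L N) : lieD T a (ε f) = ε (lieD T a f) := by
  ext l
  induction l generalizing f with
  | nil => simp
  | cons b l ih =>
    rw [apply_cons, apply_cons]; simp only [ι_lieD, ι_ε, map_sub, map_neg, neg_sub, sub_apply, neg_apply, ih]
    abel

lemma lieD_mul {S : Type*} [Ring S] (T : S →+ S) (hT : ∀ x y, T (x * y) = T x * y + x * T y) (a : L)
    (f g : ListForm L S) : lieD T a (f * g) = lieD T a f * g + f * lieD T a g := by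
  ext l
  induction l generalizing f g with
  | nil => simp [hT]
  | cons b l ih =>
    rw [apply_cons, apply_cons]
    simp only [ι_lieD, ι_mul, map_add, sub_apply, add_apply, ih, lieD_ε, sub_mul, mul_sub]
    abel

/-- The differential, defined by Cartan's formula `ι_a d = L_a - d ι_a`, for a family `T` of
additive operators on the values. -/
def dAux (T : L → N →+ N) : List L → ListForm L N → N
  | [], _ => 0
  | a :: l, f => lieD (T a) a f l - dAux T l (ι a f)

lemma dAux_add (T : L → N →+ N) (l : List L) : ∀ f g : ListForm L N,
    dAux T l (f + g) = dAux T l f + dAux T l g := by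
  induction l with
  | nil => intro f g; simp [dAux]
  | cons b l ih => intro f g; simp only [dAux, map_add, ih, add_apply]; abel

/-- The Lie algebroid differential of inhomogeneous forms, with `T` the action on the coefficients. -/
def d (T : L → N →+ N) : ListForm L N →+ ListForm L N where
  toFun f := ⟨fun l => dAux T l f⟩
  map_zero' := by
    ext l
    have := dAux_add T l (0 : ListForm L N) 0
    rw [add_zero, left_eq_add] at this
    exact this
  map_add' f g := ext fun l => dAux_add T l f g

@[simp] lemma d_nil (T : L → N →+ N) (f : ListForm L N) : d T f [] = 0 := rfl

lemma ι_d (T : L → N →+ N) (a : L) (f : ListForm L N) : ι a (d T f) = lieD (T a) a f - d T (ι a f) := rfl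

lemma d_cons (T : L → N →+ N) (a : L) (f : ListForm L N) (l) :
    d T f (a :: l) = lieD (T a) a f l - d T (ι a f) l := rfl

lemma d_ε (T : L → N →+ N) (f : ListForm L N) : d T (ε f) = -ε (d T f) := by
  ext l
  induction l generalizing f with
  | nil => simp
  | cons b l ih =>
    rw [apply_cons, apply_cons]
    simp only [ι_d, ι_ε, map_sub, map_neg, sub_apply, neg_apply, ih, lieD_ε]
    abel

/-- The graded Leibniz rule, by contraction: Cartan's formula reduces it to the derivation property
of `lieD` and to the rule itself on a shorter list. Flatness of `T` is not involved. -/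
lemma d_mul {S : Type*} [Ring S] (T : L → S →+ S) (hT : ∀ a x y, T a (x * y) = T a x * y + x * T a y)
    (f g : ListForm L S) : d T (f * g) = d T f * g + ε f * d T g := by
  ext l
  induction l generalizing f g with
  | nil => simp
  | cons b l ih =>
    rw [apply_cons, apply_cons]
    simp only [ι_d, ι_ε, ι_mul, map_add, sub_apply, add_apply, ih, lieD_mul _ (hT b),
      sub_mul, mul_sub, d_ε, neg_mul, neg_apply, ε_ε]
    abel

lemma map_adSum {N' : Type*} [AddCommGroup N'] (τ : N →+ N') (a : L) (l : List L) :
    ∀ f : ListForm L N, τ (adSum a l f) = adSum a l (map τ f) := by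
  induction l with
  | nil => intro f; simp [adSum]
  | cons b l ih => intro f; simp [adSum, ih]

/-- Used for the trace, which intertwines the connection on endomorphisms with the anchor action on
functions. -/
lemma map_d {N' : Type*} [AddCommGroup N'] (τ : N →+ N') (T : L → N →+ N) (T' : L → N' →+ N')
    (h : ∀ a x, τ (T a x) = T' a (τ x)) (f : ListForm L N) : map τ (d T f) = d T' (map τ f) := by
  ext l
  induction l generalizing f with
  | nil => simp
  | cons b l ih =>
    rw [apply_cons, apply_cons, ι_map]
    simp only [ι_d, map_sub, sub_apply, ih, ι_map]
    simp [lieD_apply, map_adSum, h]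

lemma d_one {S : Type*} [Ring S] (T : L → S →+ S) (hT : ∀ a x y, T a (x * y) = T a x * y + x * T a y) :
    d T (1 : ListForm L S) = 0 := by
  have := d_mul T hT 1 1
  simpa using this

end Differential
end ListForm

namespace ListForm

/-! ### Splitting permutations by the position of the first vector. -/

section Permutations
variable {L S : Type*} [AddCommGroup S]

lemma ofFn_insertNth {n : ℕ} (p : Fin (n + 1)) (a : L) (w : Fin n → L) :
    List.ofFn (p.insertNth (α := fun _ => L) a w) = (List.ofFn w).insertIdx p a := by
  induction n with
  | zero =>
    obtain rfl : p = 0 := Fin.fin_one_eq_zero p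
    simp
  | succ n ih =>
    induction p using Fin.cases with
    | zero => simp
    | succ p =>
      induction w using Fin.consCases with
      | cons b w => rw [Fin.insertNth_succ_cons, List.ofFn_cons, ih]; simp

-- Together with the next two lemmas: inserting `a` into a list that is then cut in two affects only
-- the block in which `a` lands.
omit [AddCommGroup S] in
lemma take_succ_insertIdx (a : L) (l : List L) : ∀ p k : ℕ, p ≤ k →
    (l.insertIdx p a).take (k + 1) = (l.take k).insertIdx p a := by
  induction l with
  | nil => intro p k _; cases p <;> simp
  | cons b l ih =>
    intro p k h
    cases p with
    | zero => simp
    | succ p =>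
      obtain ⟨k, rfl⟩ : ∃ j, k = j + 1 := ⟨k - 1, by omega⟩
      simp [ih p k (by omega)]

lemma drop_succ_insertIdx (a : L) (l : List L) : ∀ p k : ℕ, p ≤ k → p ≤ l.length →
    (l.insertIdx p a).drop (k + 1) = l.drop k := by
  induction l with
  | nil => intro p k _ h; obtain rfl : p = 0 := by simpa using h
           simp
  | cons b l ih =>
    intro p k h hl
    cases p with
    | zero => simp
    | succ p =>
      obtain ⟨k, rfl⟩ : ∃ j, k = j + 1 := ⟨k - 1, by omega⟩
      simp [ih p k (by omega) (by simpa using hl)]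

lemma drop_insertIdx_add (a : L) (l : List L) : ∀ p k : ℕ, k ≤ l.length →
    (l.insertIdx (k + p) a).drop k = (l.drop k).insertIdx p a := by
  induction l with
  | nil => intro p k h; obtain rfl : k = 0 := by simpa using h
           simp
  | cons b l ih =>
    intro p k h
    cases k with
    | zero => simp
    | succ k =>
      rw [Nat.add_right_comm]
      simp [ih p k (by simpa using h)]

/-- A permutation of `Fin (n + 1)` is given by the preimage of `0` and a permutation of `Fin n`. -/
def permEquiv (n : ℕ) : Fin (n + 1) × Equiv.Perm (Fin n) ≃ Equiv.Perm (Fin (n + 1)) :=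
  -- The cycle moves position `p` to `0` and has sign `(-1)^p`; the remaining positions are then
  -- permuted by `τ`, with `0` fixed.
  Equiv.ofBijective (fun x => Equiv.Perm.decomposeFin.symm (0, x.2) * x.1.cycleRange) <| by
    refine (Fintype.bijective_iff_injective_and_card _).2 ⟨?_, ?_⟩
    · rintro ⟨p, τ⟩ ⟨p', τ'⟩ h
      have h0 : p = p' := by
        have h1 := Equiv.congr_fun h p
        simp only [Equiv.Perm.mul_apply, Fin.cycleRange_self,
          Equiv.Perm.decomposeFin_symm_apply_zero] at h1
        have h2 : p'.cycleRange p = 0 := by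
          apply (Equiv.Perm.decomposeFin.symm (0, τ')).injective
          rw [← h1, Equiv.Perm.decomposeFin_symm_apply_zero]
        rw [← Fin.cycleRange_self p'] at h2
        exact p'.cycleRange.injective h2
      subst h0
      have := Equiv.Perm.decomposeFin.symm.injective (mul_right_cancel h)
      simpa using this
    · simp [Fintype.card_perm, Nat.factorial_succ]

/-- Expansion of an antisymmetrisation by the position `p` at which `a` ends up, each position
costing `(-1)^p`. -/
lemma sum_perm_cons {n : ℕ} (T : List L → S) (a : L) (v : Fin n → L) :
    ∑ σ : Equiv.Perm (Fin (n + 1)), (Equiv.Perm.sign σ : ℤ) •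
        T (List.ofFn ((Fin.cons a v : Fin (n + 1) → L) ∘ σ)) =
      ∑ p : Fin (n + 1), (-1 : ℤ) ^ (p : ℕ) • ∑ τ : Equiv.Perm (Fin n),
        (Equiv.Perm.sign τ : ℤ) • T ((List.ofFn (v ∘ τ)).insertIdx p a) := by
  rw [← (permEquiv n).sum_comp, Fintype.sum_prod_type]
  refine Finset.sum_congr rfl fun p _ => ?_
  rw [Finset.smul_sum]
  refine Finset.sum_congr rfl fun τ _ => ?_
  have h : (Fin.cons a v : Fin (n + 1) → L) ∘ permEquiv n (p, τ) =
      p.insertNth (α := fun _ => L) a (v ∘ τ) := by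
    symm
    refine Fin.insertNth_eq_iff.2 ⟨?_, ?_⟩
    · simp [permEquiv]
    · ext j
      simp [permEquiv, Fin.removeNth]
  rw [h, ofFn_insertNth, smul_smul]
  congr 1
  simp [permEquiv, Equiv.Perm.decomposeFin.symm_sign, mul_comm]

end Permutations

/-! ### Alternating maps as list forms. -/

section OfAlternating

variable {C L N : Type*} [CommRing C] [AddCommGroup L] [Module C L] [AddCommGroup N] [Module C N]

/-- The value of an alternating map on a list; zero unless the list has the right length. -/
def evalList : {k : ℕ} → (L [⋀^Fin k]→ₗ[C] N) → List L → N
  | 0, θ, [] => θ ![]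
  | 0, _, _ :: _ => 0
  | _ + 1, _, [] => 0
  | _ + 1, θ, a :: l => evalList (θ.curryLeft a) l

/-- An alternating map as a function on lists. -/
def ofAlt {k : ℕ} (θ : L [⋀^Fin k]→ₗ[C] N) : ListForm L N := ⟨evalList θ⟩

@[simp] lemma ofAlt_zero_nil (θ : L [⋀^Fin 0]→ₗ[C] N) : ofAlt θ [] = θ ![] := rfl
@[simp] lemma ofAlt_succ_nil {k : ℕ} (θ : L [⋀^Fin (k + 1)]→ₗ[C] N) : ofAlt θ [] = 0 := rfl
@[simp] lemma ι_ofAlt_zero (θ : L [⋀^Fin 0]→ₗ[C] N) (a : L) : ι a (ofAlt θ) = 0 := rfl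
@[simp] lemma ι_ofAlt_succ {k : ℕ} (θ : L [⋀^Fin (k + 1)]→ₗ[C] N) (a : L) :
    ι a (ofAlt θ) = ofAlt (θ.curryLeft a) := rfl

lemma ofAlt_of_length_ne {k : ℕ} (θ : L [⋀^Fin k]→ₗ[C] N) (l : List L) (h : l.length ≠ k) :
    ofAlt θ l = 0 := by
  induction k generalizing l with
  | zero => cases l with
    | nil => simp at h
    | cons a l => simp
  | succ k ih => cases l with
    | nil => simp
    | cons a l => simpa using ih (θ.curryLeft a) l (by simpa using h)

@[simp] lemma ofAlt_ofFn {k : ℕ} (θ : L [⋀^Fin k]→ₗ[C] N) (v : Fin k → L) :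
    ofAlt θ (List.ofFn v) = θ v := by
  induction k with
  | zero => simp; congr 1; exact Subsingleton.elim _ _
  | succ k ih =>
    rw [List.ofFn_succ, apply_cons, ι_ofAlt_succ, ih]
    simp [Matrix.vecCons, Fin.cons_self_tail, ← Fin.tail_def]

lemma ofAlt_injective {k : ℕ} : Function.Injective (ofAlt : (L [⋀^Fin k]→ₗ[C] N) → ListForm L N) := by
  intro θ η h
  ext v
  rw [← ofAlt_ofFn, h, ofAlt_ofFn]

-- The bridge back to `Fin`-indexed arguments: forms concentrated in one degree need comparison only
-- on lists of that length.
omit [AddCommGroup L] in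
lemma ext_ofFn {k : ℕ} {f g : ListForm L N} (hf : ∀ l, l.length ≠ k → f l = 0)
    (hg : ∀ l, l.length ≠ k → g l = 0) (h : ∀ v : Fin k → L, f (List.ofFn v) = g (List.ofFn v)) :
    f = g := by
  ext l
  by_cases hl : l.length = k
  · subst hl
    simpa using h l.get
  · rw [hf l hl, hg l hl]

lemma ofAlt_add {k : ℕ} (θ η : L [⋀^Fin k]→ₗ[C] N) : ofAlt (θ + η) = ofAlt θ + ofAlt η :=
  ext_ofFn (k := k) (ofAlt_of_length_ne _) (fun l hl => by simp [ofAlt_of_length_ne _ l hl])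
    fun v => by simp

lemma ε_ofAlt {k : ℕ} (θ : L [⋀^Fin k]→ₗ[C] N) : ε (ofAlt θ) = (-1 : ℤ) ^ k • ofAlt θ := by
  ext l
  rw [ε_apply]
  by_cases hl : l.length = k
  · rw [hl]; rfl
  · rw [ofAlt_of_length_ne _ _ hl, smul_zero]
    change 0 = (-1 : ℤ) ^ k • ofAlt θ l
    rw [ofAlt_of_length_ne _ _ hl, smul_zero]

lemma ofAlt_insertIdx {k : ℕ} (θ : L [⋀^Fin (k + 1)]→ₗ[C] N) (a : L) (l : List L) (p : ℕ)
    (hp : p ≤ k) (hl : l.length = k) :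
    ofAlt θ (l.insertIdx p a) = (-1 : ℤ) ^ p • ofAlt (θ.curryLeft a) l := by
  obtain ⟨v, rfl⟩ : ∃ v : Fin k → L, l = List.ofFn v := by
    subst hl
    exact ⟨l.get, (List.ofFn_get l).symm⟩
  rw [← ofFn_insertNth ⟨p, Nat.lt_succ_of_le hp⟩, ofAlt_ofFn, AlternatingMap.map_insertNth, ofAlt_ofFn]
  simp

lemma ofAlt_comp {N' : Type*} [AddCommGroup N'] [Module C N'] (τ : N →ₗ[C] N') {k : ℕ}
    (θ : L [⋀^Fin k]→ₗ[C] N) :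
    ofAlt (τ.compAlternatingMap θ) = map τ.toAddMonoidHom (ofAlt θ) :=
  ext_ofFn (k := k) (ofAlt_of_length_ne _) (fun l hl => by simp [ofAlt_of_length_ne _ l hl])
    fun v => by simp

end OfAlternating
-- The wedge product is the shuffle product.
section Wedge

lemma mul_of_length_ne {L S : Type*} [Ring S] {k m : ℕ} {f g : ListForm L S}
    (hf : ∀ l, l.length ≠ k → f l = 0) (hg : ∀ l, l.length ≠ m → g l = 0) (l : List L)
    (hl : l.length ≠ k + m) : (f * g) l = 0 := by
  induction l generalizing k m f g with
  | nil =>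
    by_cases hk : k = 0
    · rw [mul_nil, hg [] (by simp at hl ⊢; omega), mul_zero]
    · rw [mul_nil, hf [] (by simp; omega), zero_mul]
  | cons a l ih =>
    have hε : ∀ l : List L, l.length ≠ k → ε f l = 0 := fun l h => by rw [ε_apply, hf l h, smul_zero]
    rw [apply_cons, ι_mul, add_apply]
    have h1 : (ι a f * g) l = 0 := by
      cases k with
      | zero =>
        have : ι a f = 0 := ext fun l => hf _ (by simp)
        rw [this, zero_mul, zero_apply]
      | succ k =>
        exact ih (k := k) (fun l h => hf _ (by simpa using h)) hg (by simp at hl; omega)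
    have h2 : (ε f * ι a g) l = 0 := by
      cases m with
      | zero =>
        have : ι a g = 0 := ext fun l => hg _ (by simp)
        rw [this, mul_zero, zero_apply]
      | succ m =>
        exact ih hε (m := m) (fun l h => hg _ (by simpa using h)) (by simp at hl; omega)
    rw [h1, h2, add_zero]

variable {C L S : Type*} [CommRing C] [LieRing L] [Module C L] [Ring S] [Algebra C S]

-- The recursion for the shuffle product matches the expansion of the sum over permutations by the
-- position of the first vector `a`: in the first `k` positions `a` is an argument of `θ`, in the
-- last `m` of `η`. The degree `n` is a separate variable so that induction can lower either `k` or
-- `m`.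
open Nat in
lemma factorial_smul_mul_ofFn (n : ℕ) : ∀ {k m : ℕ} (_ : k + m = n) (θ : L [⋀^Fin k]→ₗ[C] S)
    (η : L [⋀^Fin m]→ₗ[C] S) (v : Fin n → L),
    (k ! * m !) • (ofAlt θ * ofAlt η) (List.ofFn v) = ∑ σ : Equiv.Perm (Fin n),
      (Equiv.Perm.sign σ : ℤ) • (ofAlt θ ((List.ofFn (v ∘ σ)).take k) *
        ofAlt η ((List.ofFn (v ∘ σ)).drop k)) := by
  induction n with
  | zero =>
    intro k m h θ η v
    obtain ⟨rfl, rfl⟩ : k = 0 ∧ m = 0 := by omega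
    simp
  | succ n ih =>
    intro k m h θ η v
    induction v using Fin.consCases with | cons a v => ?_
    rw [sum_perm_cons (fun l => ofAlt θ (l.take k) * ofAlt η (l.drop k)), List.ofFn_cons, apply_cons,
      ι_mul, add_apply, smul_add]
    set F : ℕ → S := fun p => (-1 : ℤ) ^ p • ∑ τ : Equiv.Perm (Fin n), (Equiv.Perm.sign τ : ℤ) •
      (ofAlt θ (((List.ofFn (v ∘ τ)).insertIdx p a).take k) *
        ofAlt η (((List.ofFn (v ∘ τ)).insertIdx p a).drop k)) with hF
    -- `X` is the common contribution of the `k` positions in the first block: the sign for moving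
    -- `a` to the front of `θ` cancels `(-1)^p`. This accounts for the factor in `k! = k (k-1)!`.
    obtain ⟨X, hX, hFX⟩ : ∃ X, (k ! * m !) • (ι a (ofAlt θ) * ofAlt η) (List.ofFn v) = k • X ∧
        ∀ p < k, F p = X := by
      cases k with
      | zero => exact ⟨0, by simp, by simp⟩
      | succ k =>
        refine ⟨∑ τ : Equiv.Perm (Fin n), (Equiv.Perm.sign τ : ℤ) •
          (ofAlt (θ.curryLeft a) ((List.ofFn (v ∘ τ)).take k) *
            ofAlt η ((List.ofFn (v ∘ τ)).drop k)), ?_, fun p hp => ?_⟩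
        · rw [ι_ofAlt_succ, factorial_succ, mul_assoc, mul_smul, ih (by omega)]
        · rw [hF]
          simp only [Finset.smul_sum]
          refine Finset.sum_congr rfl fun τ _ => ?_
          have h1 : ((List.ofFn (v ∘ τ)).insertIdx p a).take (k + 1) =
            ((List.ofFn (v ∘ τ)).take k).insertIdx p a := take_succ_insertIdx _ _ _ _ (by omega)
          have h2 : ((List.ofFn (v ∘ τ)).insertIdx p a).drop (k + 1) =
            (List.ofFn (v ∘ τ)).drop k := drop_succ_insertIdx _ _ _ _ (by omega) (by simp; omega)
          rw [h1, h2, ofAlt_insertIdx _ _ _ _ (by omega) (by simp; omega), smul_comm, smul_mul_assoc,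
            smul_smul ((-1 : ℤ) ^ p), ← mul_pow]
          simp
    -- `Y` is the same for the second block. Of the sign `(-1)^(k+p)` only `(-1)^k` remains, and
    -- this is the sign of `ε (ofAlt θ)`.
    obtain ⟨Y, hY, hFY⟩ : ∃ Y, (k ! * m !) • (ε (ofAlt θ) * ι a (ofAlt η)) (List.ofFn v) = m • Y ∧
        ∀ p < m, F (k + p) = Y := by
      cases m with
      | zero => exact ⟨0, by simp, by simp⟩
      | succ m =>
        refine ⟨(-1 : ℤ) ^ k • ∑ τ : Equiv.Perm (Fin n), (Equiv.Perm.sign τ : ℤ) •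
          (ofAlt θ ((List.ofFn (v ∘ τ)).take k) *
            ofAlt (η.curryLeft a) ((List.ofFn (v ∘ τ)).drop k)), ?_, fun p hp => ?_⟩
        · rw [ι_ofAlt_succ, factorial_succ, mul_left_comm, mul_smul, ε_ofAlt, smul_mul_assoc]
          congr 1
          change _ • (-1 : ℤ) ^ k • (ofAlt θ * ofAlt (η.curryLeft a)) _ = _
          rw [smul_comm, ih (by omega)]
        · rw [hF]
          simp only [Finset.smul_sum]
          refine Finset.sum_congr rfl fun τ _ => ?_
          have h1 : ((List.ofFn (v ∘ τ)).insertIdx (k + p) a).take k =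
            (List.ofFn (v ∘ τ)).take k := List.take_insertIdx_eq_take_of_le _ _ _ _ (by omega)
          have h2 : ((List.ofFn (v ∘ τ)).insertIdx (k + p) a).drop k =
            ((List.ofFn (v ∘ τ)).drop k).insertIdx p a := drop_insertIdx_add _ _ _ _ (by simp; omega)
          rw [h1, h2, ofAlt_insertIdx _ _ _ _ (by omega) (by simp; omega), mul_smul_comm, pow_add,
            mul_smul]
          congr 1
          rw [smul_comm, smul_smul ((-1 : ℤ) ^ p), ← mul_pow]
          simp
    rw [hX, hY, Fin.sum_univ_eq_sum_range F, ← h, Finset.sum_range_add]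
    rw [Finset.sum_congr rfl fun p hp => hFX p (Finset.mem_range.1 hp),
      Finset.sum_congr rfl fun p hp => hFY p (Finset.mem_range.1 hp)]
    simp

-- After multiplication by `k! m!` both sides become the full antisymmetrisation of `θ ⊗ η`; the
-- factor is cancelled because the values are torsion free.
open Nat in
lemma ofAlt_wedge [IsAddTorsionFree S] {k m : ℕ} (θ : L [⋀^Fin k]→ₗ[C] S) (η : L [⋀^Fin m]→ₗ[C] S) :
    ofAlt (wedge θ η) = ofAlt θ * ofAlt η := by
  refine ext_ofFn (k := k + m) (ofAlt_of_length_ne _) (mul_of_length_ne (ofAlt_of_length_ne _)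
    (ofAlt_of_length_ne _)) fun v => ?_
  rw [ofAlt_ofFn]
  refine nsmul_right_injective (mul_ne_zero k.factorial_ne_zero m.factorial_ne_zero) ?_
  dsimp only
  rw [factorial_smul_mul_ofFn _ rfl]
  have h := MultilinearMap.domCoprod_alternization_eq θ η
  rw [Fintype.card_fin, Fintype.card_fin] at h
  have h2 := congrArg (fun g => LinearMap.mul' C S (g (v ∘ finSumFinEquiv))) h
  simp only [AlternatingMap.smul_apply, map_nsmul] at h2
  refine h2.symm.trans ?_
  rw [MultilinearMap.alternatization_apply, map_sum, ← (Equiv.permCongr finSumFinEquiv).sum_comp]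
  refine Finset.sum_congr rfl fun σ _ => ?_
  rw [Equiv.Perm.sign_permCongr, Units.smul_def, map_zsmul]
  congr 1
  rw [List.ofFn_add, List.take_left' (by simp), List.drop_left' (by simp)]
  have h3 : ∀ i : Fin k, finSumFinEquiv.symm (Fin.castLE (Nat.le_add_right k m) i) = Sum.inl i :=
    fun i => finSumFinEquiv_symm_apply_castAdd i
  simp [MultilinearMap.domCoprod_apply, Function.comp_def, h3]

end Wedge

/-! ### The Koszul formula is the Cartan differential. -/

section Koszul

variable {C L N : Type*} [CommRing C] [LieRing L] [Module C L] [LieRingModule L C]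
  [AddCommGroup N] [Module C N]

/-- A connection as a family of additive operators. -/
def _root_.LieRinehart.Connection.op (D : Connection C L N) (a : L) : N →+ N where
  toFun := D a
  map_zero' := D.zero_right a
  map_add' := D.add_right a

@[simp] lemma _root_.LieRinehart.Connection.op_apply (D : Connection C L N) (a : L) (n : N) :
    D.op a n = D a n := rfl

omit [LieRingModule L C] in
lemma adSum_ofFn {k : ℕ} (θ : L [⋀^Fin k]→ₗ[C] N) (a : L) (v : Fin k → L) :
    adSum a (List.ofFn v) (ofAlt θ) = ∑ j, θ (Function.update v j ⁅a, v j⁆) := by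
  induction k with
  | zero => simp [adSum]
  | succ k ih =>
    induction v using Fin.consCases with | cons b v => ?_
    rw [List.ofFn_cons, adSum, Fin.sum_univ_succ, ι_ofAlt_succ, ih]
    congr 1
    · rw [← List.ofFn_cons, ofAlt_ofFn]
      simp
    · refine Finset.sum_congr rfl fun j _ => ?_
      rw [AlternatingMap.curryLeft_apply_apply, ← Fin.cons_update]
      simp [Matrix.vecCons]

/-- The summand `i = 0` of the Koszul formula is the Lie derivative along `a_0`, as then no `j` is
excluded. The others form minus the Koszul formula of the contraction with `a_0`: for `i > 0` the
slot `j = 0` is excluded, so `a_0` is never bracketed there. -/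
lemma d_ofAlt_ofFn (D : Connection C L N) {k : ℕ} (θ : L [⋀^Fin k]→ₗ[C] N) (v : Fin (k + 1) → L) :
    d D.op (ofAlt θ) (List.ofFn v) = koszul D θ v := by
  induction k with
  | zero =>
    have h : Fin.tail v = ![] := Subsingleton.elim _ _
    simp [koszul, ι_d, h]
  | succ k ih =>
    induction v using Fin.consCases with | cons a v => ?_
    rw [List.ofFn_cons, d_cons, ι_ofAlt_succ, ih]
    conv_rhs => rw [koszul, Fin.sum_univ_succ]
    rw [sub_eq_add_neg]
    congr 1
    · rw [lieD_apply, adSum_ofFn, ofAlt_ofFn]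
      simp
    · rw [koszul, ← Finset.sum_neg_distrib]
      refine Finset.sum_congr rfl fun i _ => ?_
      have h : i.succ.removeNth (α := fun _ => L) (Fin.cons a v) = Fin.cons a (i.removeNth v) := by
        ext j
        induction j using Fin.cases <;> simp [Fin.removeNth]
      rw [h, Fin.cons_succ, Fin.val_succ, pow_succ, mul_neg_one, neg_smul]
      congr 3
      rw [Finset.sum_filter, Finset.sum_filter, Fin.sum_univ_succ]
      simp [← Fin.cons_update, Matrix.vecCons]

omit [LieRingModule L C] in
lemma adSum_of_length_ne {k : ℕ} {f : ListForm L N} (hf : ∀ l, l.length ≠ k → f l = 0) (a : L)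
    (l : List L) (hl : l.length ≠ k) : adSum a l f = 0 := by
  induction l generalizing k f with
  | nil => rfl
  | cons b l ih =>
    rw [adSum, hf _ (by simpa using hl), zero_add]
    cases k with
    | zero =>
      have : ι b f = 0 := ext fun l => hf _ (by simp)
      rw [this]
      simpa using adSum_add a l (0 : ListForm L N) 0
    | succ k => exact ih (k := k) (fun l h => hf _ (by simpa using h)) (by simpa using hl)

lemma d_of_length_ne (T : L → N →+ N) {k : ℕ} {f : ListForm L N} (hf : ∀ l, l.length ≠ k → f l = 0)
    (l : List L) (hl : l.length ≠ k + 1) : d T f l = 0 := by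
  induction l generalizing k f with
  | nil => rfl
  | cons b l ih =>
    have hl' : l.length ≠ k := by simpa using hl
    rw [d_cons, lieD_apply, hf _ hl', adSum_of_length_ne hf _ _ hl', map_zero, sub_zero, zero_sub,
      neg_eq_zero]
    cases k with
    | zero =>
      have : ι b f = 0 := ext fun l => hf _ (by simp)
      rw [this, map_zero, zero_apply]
    | succ k => exact ih (k := k) (fun l h => hf _ (by simpa using h)) hl'

end Koszul

end ListForm

namespace ListForm

open Polynomial

/-! ### Transgression along the line of connections `∇ + X η`. -/

section Transgression

variable {L S S' : Type*} [LieRing L] [Ring S] [AddCommGroup S']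
  {T : L → S →+ S} (hT : ∀ a x y, T a (x * y) = T a x * y + x * T a y)
  {R F η : ListForm L S} (hR : ε R = R) (hη : ε η = -η)
  (hdR : d T R = 0) (hdη : d T η = F) (hdF : d T F = R * η - η * R)

/-- The polynomial `R + X F + X² η²`; for `F = d η` it is the curvature of the connection `∇ + X η`,
if `R` is the curvature of `∇`. -/
def curvaturePoly (R F η : ListForm L S) : (ListForm L S)[X] := C R + C F * X + C (η * η) * X ^ 2

omit [LieRing L] in
lemma coeff_curvaturePoly (R F η : ListForm L S) (m : ℕ) : (curvaturePoly R F η).coeff m =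
    match m with
    | 0 => R
    | 1 => F
    | 2 => η * η
    | _ + 3 => 0 := by
  rcases m with _ | _ | _ | m <;>
    simp [curvaturePoly, coeff_C, coeff_X, coeff_X_pow, coeff_C_mul, -map_mul]

omit [LieRing L] in
lemma ε_coeff_mul {P Q : (ListForm L S)[X]} (hP : ∀ m, ε (P.coeff m) = P.coeff m)
    (hQ : ∀ m, ε (Q.coeff m) = Q.coeff m) (m : ℕ) : ε ((P * Q).coeff m) = (P * Q).coeff m := by
  simp [coeff_mul, hP, hQ]

omit [LieRing L] in
lemma ε_coeff_pow {P : (ListForm L S)[X]} (hP : ∀ m, ε (P.coeff m) = P.coeff m) (n m : ℕ) :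
    ε ((P ^ n).coeff m) = (P ^ n).coeff m := by
  induction n generalizing m with
  | zero =>
    rw [pow_zero, coeff_one]
    split_ifs <;> simp
  | succ n ih => rw [pow_succ]; exact ε_coeff_mul ih hP m

include hT in
lemma d_coeff_mul {P P' Q Q' : (ListForm L S)[X]} (hP : ∀ m, ε (P.coeff m) = P.coeff m)
    (hP' : ∀ m, d T (P.coeff m) = P'.coeff m) (hQ' : ∀ m, d T (Q.coeff m) = Q'.coeff m) (m : ℕ) :
    d T ((P * Q).coeff m) = (P' * Q + P * Q').coeff m := by
  simp [coeff_mul, hP, hP', hQ', d_mul T hT, Finset.sum_add_distrib]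

-- `F = dη` is even because `d` and `η` are odd.
include hR hη hdη in
lemma ε_coeff_curvaturePoly (m : ℕ) :
    ε ((curvaturePoly R F η).coeff m) = (curvaturePoly R F η).coeff m := by
  have hF : ε F = F := by rw [← hdη, ← neg_eq_iff_eq_neg.2 (d_ε T η), hη, map_neg, neg_neg]
  rcases m with _ | _ | _ | m <;> simp [coeff_curvaturePoly, hR, hF, hη]

-- The Bianchi identity for `∇ + X η`, degree by degree: `dR = 0`, `dF = [R, η]`, `d(η²) = [F, η]`,
-- and `[η², η] = 0` in degree three.
include hT hη hdR hdη hdF in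
lemma d_coeff_curvaturePoly (m : ℕ) : d T ((curvaturePoly R F η).coeff m) =
    (X * (curvaturePoly R F η * C η - C η * curvaturePoly R F η)).coeff m := by
  rcases m with _ | _ | _ | _ | m
  · simp [coeff_curvaturePoly, hdR]
  all_goals
    simp [coeff_curvaturePoly, coeff_X_mul, coeff_mul_C, coeff_C_mul, hdη, hdF, d_mul T hT, hη,
      mul_assoc, sub_eq_add_neg]

-- The commutator with `η` is a derivation and `X` is central, so the Bianchi identity passes to
-- powers.
include hT hR hη hdR hdη hdF in
lemma d_coeff_curvaturePoly_pow (n m : ℕ) : d T ((curvaturePoly R F η ^ n).coeff m) =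
    (X * (curvaturePoly R F η ^ n * C η - C η * curvaturePoly R F η ^ n)).coeff m := by
  induction n generalizing m with
  | zero =>
    rw [pow_zero, coeff_one]
    split_ifs <;> simp [d_one T hT]
  | succ n ih =>
    rw [pow_succ, d_coeff_mul hT (ε_coeff_pow (ε_coeff_curvaturePoly hR hη hdη) n) ih
      (d_coeff_curvaturePoly hT hη hdR hdη hdF)]
    congr 1
    rw [← mul_assoc (_ ^ n) X, ← X_mul]
    noncomm_ring

variable {τ : S →+ S'} (hτ : ∀ x y, τ (x * y) = τ (y * x))

omit [LieRing L] in
include hτ in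
lemma map_coeff_mul_comm {P : (ListForm L S)[X]} (hP : ∀ m, ε (P.coeff m) = P.coeff m)
    (Q : (ListForm L S)[X]) (m : ℕ) : map τ ((P * Q).coeff m) = map τ ((Q * P).coeff m) := by
  rw [coeff_mul, coeff_mul, map_sum, map_sum, ← Finset.Nat.sum_antidiagonal_swap]
  exact Finset.sum_congr rfl fun x _ => map_mul_comm_of_even τ hτ (hP _) _

omit [LieRing L] in
-- Under the trace the factors of `(P^(n+1))'` can be rotated until `P'` stands in front. The spare
-- factor `P^k` makes the induction on `n` close.
include hτ in
lemma map_coeff_derivative_pow {P : (ListForm L S)[X]} (hP : ∀ m, ε (P.coeff m) = P.coeff m)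
    (n k m : ℕ) : map τ ((derivative (P ^ (n + 1)) * P ^ k).coeff m) =
      (n + 1) • map τ ((derivative P * P ^ (n + k)).coeff m) := by
  induction n generalizing k with
  | zero => simp
  | succ n ih =>
    rw [pow_succ, derivative_mul, add_mul, coeff_add, map_add, mul_assoc, ← pow_succ', ih, mul_assoc,
      map_coeff_mul_comm hτ (ε_coeff_pow hP _), mul_assoc, ← pow_add, succ_nsmul _ (n + 1)]
    congr 4 <;> ring_nf

-- `d(η P^n) = F P^n - X η P^n η + X η² P^n`. Cyclicity turns `-η P^n η` into `+η² P^n` since `η` is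
-- odd, and `F + 2 X η²` is the derivative of `P`.
include hT hR hη hdR hdη hdF hτ in
lemma map_d_mul_coeff_curvaturePoly_pow (n m : ℕ) :
    map τ (d T (η * (curvaturePoly R F η ^ n).coeff m)) =
      map τ ((derivative (curvaturePoly R F η) * curvaturePoly R F η ^ n).coeff m) := by
  have hP := ε_coeff_pow (ε_coeff_curvaturePoly hR hη hdη (F := F)) n
  rw [d_mul T hT, d_coeff_curvaturePoly_pow hT hR hη hdR hdη hdF, hdη, hη]
  set P := curvaturePoly R F η with hPdef
  have h1 : derivative P * P ^ n = C F * P ^ n + X * (C (η * η) * P ^ n) +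
      X * (C (η * η) * P ^ n) := by
    have : derivative P = C F + X * C (η * η) + X * C (η * η) := by
      ext1 m
      rw [hPdef, coeff_derivative]
      rcases m with _ | _ | m
      · simp [coeff_curvaturePoly]
      · simp [coeff_curvaturePoly, coeff_C, mul_add, -map_mul]
      · simp [coeff_curvaturePoly, -map_mul]
    rw [this]
    noncomm_ring
  rw [h1]
  -- Moving the odd `η` past the odd `P^n η` under the trace produces the sign.
  have h2 : map τ ((X * (C η * (P ^ n * C η))).coeff m) = - map τ ((X * (C (η * η) * P ^ n)).coeff m) := by
    cases m with
    | zero => simp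
    | succ m =>
      simp only [coeff_X_mul, coeff_C_mul, coeff_mul_C]
      rw [map_mul_comm_of_odd τ hτ hη, ← map_neg, ε_mul, hP, hη, mul_neg, neg_mul, mul_assoc,
        map_neg, map_neg, map_mul_comm_of_even τ hτ (hP m)]
  have h3 : F * (P ^ n).coeff m + -η * (X * (P ^ n * C η - C η * P ^ n)).coeff m =
      (C F * P ^ n - X * (C η * (P ^ n * C η)) + X * (C (η * η) * P ^ n)).coeff m := by
    cases m with
    | zero => simp
    | succ m => simp [coeff_C_mul, mul_sub, mul_assoc]; abel
  rw [h3, coeff_add, coeff_sub, map_add, map_sub, h2, coeff_add, coeff_add, map_add, map_add]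
  abel

-- The coefficient form of `d/dX tr(P^(n+1)) = (n+1) d tr(η P^n)`: every non-constant coefficient
-- has an integer multiple that is exact.
include hT hR hη hdR hdη hdF hτ in
lemma map_coeff_succ_curvaturePoly_pow (n m : ℕ) :
    (m + 1) • map τ ((curvaturePoly R F η ^ (n + 1)).coeff (m + 1)) =
      (n + 1) • map τ (d T (η * (curvaturePoly R F η ^ n).coeff m)) := by
  rw [map_d_mul_coeff_curvaturePoly_pow hT hR hη hdR hdη hdF hτ]
  have h := map_coeff_derivative_pow hτ (ε_coeff_curvaturePoly hR hη hdη (F := F)) n 0 m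
  rw [pow_zero, mul_one, add_zero, coeff_derivative] at h
  rw [← h, ← map_nsmul, nsmul_eq_mul']
  simp

omit [LieRing L] in
lemma sum_coeff_pow (P : (ListForm L S)[X]) (n : ℕ) :
    ∑ i ∈ Finset.range ((P ^ n).natDegree + 1), (P ^ n).coeff i = (P.eval 1) ^ n := by
  -- Over a noncommutative ring evaluation is multiplicative only at elements commuting with the
  -- coefficients, such as `1`.
  have h := map_pow (eval₂RingHom' (RingHom.id (ListForm L S)) 1 fun a => Commute.one_right a) P n
  change (P ^ n).eval 1 = (P.eval 1) ^ n at h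
  rw [← h, eval_eq_sum_range]
  simp

end Transgression

end ListForm

/-! ### Structure equations for curvature. -/

section CurvatureForms
open ListForm

variable {C L N : Type*} [CommRing C] [LieRing L] [Module C L] [LieRingModule L C]
  [AddCommGroup N] [Module C N]

lemma Connection.hom_op_mul (D : Connection C L N) (a : L) (φ ψ : Module.End C N) :
    (D.hom D).op a (φ * ψ) = (D.hom D).op a φ * ψ + φ * (D.hom D).op a ψ := by
  ext n
  simp

variable [LieRinehartRing C L]

lemma Connection.trivial_op_mul (a : L) (f g : C) :
    (Connection.trivial C L).op a (f * g) =
      (Connection.trivial C L).op a f * g + f * (Connection.trivial C L).op a g := by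
  simp [Connection.trivial, add_comm]

lemma ListForm.d_pair (T : L → N →+ N) (f : ListForm L N) (a b : L) :
    d T f [a, b] = T a (f [b]) - T b (f [a]) - f [⁅a, b⁆] := by
  simp [ι_d, ι_lieD]
  abel

lemma ListForm.d_triple (T : L → N →+ N) (f : ListForm L N) (a b c : L) :
    d T f [a, b, c] = T a (f [b, c]) - T b (f [a, c]) + T c (f [a, b]) - f [⁅a, b⁆, c] -
      f [b, ⁅a, c⁆] + f [a, ⁅b, c⁆] := by
  simp [ι_d, ι_lieD]
  abel

lemma ofAlt_curvature_pair (D : Connection C L N) (a b : L) :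
    ofAlt D.curvature [a, b] = D.curvatureEnd a b := ofAlt_ofFn D.curvature ![a, b]

/-- The Bianchi identity. -/
lemma Connection.d_curvature (D : Connection C L N) : d (D.hom D).op (ofAlt D.curvature) = 0 := by
  refine ext_ofFn (k := 3) (d_of_length_ne _ (ofAlt_of_length_ne _)) (fun _ _ => rfl) fun v => ?_
  obtain ⟨a, b, c, h⟩ : ∃ a b c, List.ofFn v = [a, b, c] := ⟨v 0, v 1, v 2, by simp [List.ofFn_succ]⟩
  rw [h, ListForm.d_triple]
  simp only [ofAlt_curvature_pair, Connection.op_apply]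
  ext n
  have hj : ⁅⁅a, b⁆, c⁆ = ⁅a, ⁅b, c⁆⁆ - ⁅b, ⁅a, c⁆⁆ := lie_lie a b c
  simp only [LinearMap.sub_apply, LinearMap.add_apply, hom_apply, curvatureEnd_apply, hj,
    sub_left, sub_right]
  change _ = (0 : N)
  abel

/-- The difference of two connections as a 1-form. -/
def Connection.sub (D₁ D₀ : Connection C L N) : L [⋀^Fin 1]→ₗ[C] Module.End C N :=
  AlternatingMap.ofSubsingleton C L _ (0 : Fin 1)
    { toFun := fun a =>
        { toFun := fun n => D₁ a n - D₀ a n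
          map_add' := fun n m => by rw [D₁.add_right, D₀.add_right]; abel
          map_smul' := fun f n => by rw [D₁.leibniz, D₀.leibniz, RingHom.id_apply, smul_sub]; abel }
      map_add' := fun a b => by
        ext n
        simp only [LinearMap.coe_mk, AddHom.coe_mk, LinearMap.add_apply, add_left]
        abel
      map_smul' := fun f a => by
        ext n
        simp only [LinearMap.coe_mk, AddHom.coe_mk, LinearMap.smul_apply, smul_left, smul_sub,
          RingHom.id_apply] }

omit [LieRinehartRing C L] in
lemma ofAlt_sub_singleton (D₁ D₀ : Connection C L N) (a : L) (n : N) :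
    ofAlt (D₁.sub D₀) [a] n = D₁ a n - D₀ a n :=
  DFunLike.congr_fun (ofAlt_ofFn (D₁.sub D₀) ![a]) n

/-- Expand `∇¹ = ∇⁰ + η` in the definition of curvature; the quadratic part `[η_a, η_b]` is `η ∧ η`.
-/
lemma ofAlt_curvature_eq (D₁ D₀ : Connection C L N) :
    ofAlt D₁.curvature = ofAlt D₀.curvature + d (D₀.hom D₀).op (ofAlt (D₁.sub D₀)) +
      ofAlt (D₁.sub D₀) * ofAlt (D₁.sub D₀) := by
  refine ext_ofFn (k := 2) (ofAlt_of_length_ne _) (fun l hl => ?_) fun v => ?_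
  · simp [ofAlt_of_length_ne _ _ hl, d_of_length_ne _ (ofAlt_of_length_ne _) l hl,
      mul_of_length_ne (ofAlt_of_length_ne (D₁.sub D₀)) (ofAlt_of_length_ne (D₁.sub D₀)) l hl]
  · obtain ⟨a, b, h⟩ : ∃ a b, List.ofFn v = [a, b] := ⟨v 0, v 1, by simp [List.ofFn_succ]⟩
    set η := ofAlt (D₁.sub D₀) with hη
    have hη0 : η [] = 0 := rfl
    have h2 : (η * η) [a, b] = η [a] * η [b] - η [b] * η [a] := by
      simp [hη0]
      abel
    rw [h, ListForm.add_apply, ListForm.add_apply, ListForm.d_pair, h2]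
    ext n
    simp only [ofAlt_curvature_pair, LinearMap.sub_apply, LinearMap.add_apply, Connection.op_apply,
      Connection.hom_apply, Connection.curvatureEnd_apply, Module.End.mul_apply, hη,
      ofAlt_sub_singleton, Connection.sub_right]
    abel

/-- The covariant differential on `End`-valued forms squares to the commutator with the curvature.
Only the 1-form `η` is needed, where the identity can be evaluated on three vectors. -/
lemma d_d_sub (D₁ D₀ : Connection C L N) :
    d (D₀.hom D₀).op (d (D₀.hom D₀).op (ofAlt (D₁.sub D₀))) =
      ofAlt D₀.curvature * ofAlt (D₁.sub D₀) - ofAlt (D₁.sub D₀) * ofAlt D₀.curvature := by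
  refine ext_ofFn (k := 3) (d_of_length_ne _ (d_of_length_ne _ (ofAlt_of_length_ne _)))
    (fun l hl => ?_) fun v => ?_
  · rw [ListForm.sub_apply, mul_of_length_ne (ofAlt_of_length_ne _) (ofAlt_of_length_ne _) l hl,
      mul_of_length_ne (ofAlt_of_length_ne _) (ofAlt_of_length_ne _) l hl, sub_zero]
  · obtain ⟨a, b, c, h⟩ : ∃ a b c, List.ofFn v = [a, b, c] :=
      ⟨v 0, v 1, v 2, by simp [List.ofFn_succ]⟩
    set η := ofAlt (D₁.sub D₀) with hη
    set R := ofAlt D₀.curvature with hR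
    have h1 : (R * η) [a, b, c] = R [a, b] * η [c] - R [a, c] * η [b] + R [b, c] * η [a] := by
      -- `η` lives in degree one and `R` in degree two, so most terms of the shuffle expansion
      -- vanish for degree reasons.
      have hη0 : η [] = 0 := rfl
      have hη2 : ∀ x y, ι y (ι x η) [] = 0 := fun x y => rfl
      have hη3 : ∀ x y z, ι z (ι y (ι x η)) [] = 0 := fun x y z => rfl
      have hR1 : ∀ x, ι x R [] = 0 := fun x => rfl
      have hR0 : R [] = 0 := rfl
      simp [hη0, hη2, hη3, hR0, hR1]
      abel
    have h2 : (η * R) [a, b, c] = η [a] * R [b, c] - η [b] * R [a, c] + η [c] * R [a, b] := by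
      have hη0 : η [] = 0 := rfl
      have hη2 : ∀ x y, ι y (ι x η) [] = 0 := fun x y => rfl
      have hη3 : ∀ x y z, ι z (ι y (ι x η)) [] = 0 := fun x y z => rfl
      have hR1 : ∀ x, ι x R [] = 0 := fun x => rfl
      have hR0 : R [] = 0 := rfl
      simp [hη0, hη2, hη3, hR0, hR1]
      abel
    rw [h, ListForm.sub_apply, h1, h2, ListForm.d_triple]
    simp only [ListForm.d_pair]
    ext n
    have hj : ⁅⁅a, b⁆, c⁆ = ⁅a, ⁅b, c⁆⁆ - ⁅b, ⁅a, c⁆⁆ := lie_lie a b c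
    simp only [hR, ofAlt_curvature_pair, LinearMap.sub_apply, LinearMap.add_apply,
      Connection.op_apply, Connection.hom_apply, Connection.curvatureEnd_apply,
      Module.End.mul_apply, hη, ofAlt_sub_singleton, Connection.sub_right, hj, Connection.sub_left]
    abel

end CurvatureForms

/-! ### Closed and exact forms in terms of list forms. -/

section Exact
open ListForm

variable {C L N : Type*} [CommRing C] [LieRing L] [Module C L] [LieRingModule L C]
  [AddCommGroup N] [Module C N] [Algebra ℝ C] [LieAlgebra ℝ L] [LieRinehartRing C L]
  [LieRinehartAlgebra ℝ C L] [Module ℝ N] [IsScalarTower ℝ C N]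

lemma isAddTorsionFree_of_real (V : Type*) [AddCommGroup V] [Module ℝ V] : IsAddTorsionFree V :=
  letI := Module.compHom V (algebraMap ℚ ℝ)
  .of_module_rat V

lemma mem_closedForms_iff (D : Connection C L N) {k : ℕ} (θ : L [⋀^Fin k]→ₗ[C] N) :
    θ ∈ closedForms D k ↔ d D.op (ofAlt θ) = 0 := by
  refine ⟨fun h => ext_ofFn (k := k + 1) (d_of_length_ne _ (ofAlt_of_length_ne _)) (fun _ _ => rfl)
    fun v => ?_, fun h v => ?_⟩
  · rw [d_ofAlt_ofFn, h v]; rfl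
  · rw [← d_ofAlt_ofFn, h]; rfl

/-- Writing the degree as `j + 1 = k` lets primitives of degrees such as `1 + 2 * n` be used without
casts; the alternative `θ = 0` covers degree zero. -/
lemma mem_exactForms_iff (D : Connection C L N) {k : ℕ} (θ : L [⋀^Fin k]→ₗ[C] N) :
    θ ∈ exactForms D k ↔ θ = 0 ∨
      ∃ (j : ℕ) (β : L [⋀^Fin j]→ₗ[C] N), j + 1 = k ∧ ofAlt θ = d D.op (ofAlt β) := by
  cases k with
  | zero => simp [exactForms]
  | succ k =>
    constructor
    · rintro ⟨β, h⟩
      refine .inr ⟨k, β, rfl, ext_ofFn (k := k + 1) (ofAlt_of_length_ne _)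
        (d_of_length_ne _ (ofAlt_of_length_ne _)) fun v => ?_⟩
      rw [d_ofAlt_ofFn, ofAlt_ofFn, h]
    · rintro (rfl | ⟨j, β, hj, h⟩)
      · exact zero_mem _
      · obtain rfl : j = k := by omega
        exact ⟨β, fun v => by rw [← d_ofAlt_ofFn, ← h, ofAlt_ofFn]⟩

end Exact

section IsAlt
open ListForm

variable {C L N : Type*} [CommRing C] [LieRing L] [Module C L] [AddCommGroup N] [Module C N]

/-- `ofAlt` as an additive map. -/
def ListForm.ofAltHom (C L N : Type*) [CommRing C] [AddCommGroup L] [Module C L]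
    [AddCommGroup N] [Module C N] (k : ℕ) : (L [⋀^Fin k]→ₗ[C] N) →+ ListForm L N :=
  AddMonoidHom.mk' ofAlt ofAlt_add

lemma ListForm.ofAltHom_apply {k : ℕ} (θ : L [⋀^Fin k]→ₗ[C] N) : ofAltHom C L N k θ = ofAlt θ := rfl

lemma ListForm.ofAlt_constOfIsEmpty_one {S : Type*} [Ring S] [Algebra C S] :
    ofAlt (AlternatingMap.constOfIsEmpty C L (Fin 0) (1 : S)) = 1 :=
  ext_ι (by simp) fun a => by simp

lemma ofAlt_wedgePow {S : Type*} [Ring S] [Algebra C S] [IsAddTorsionFree S]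
    (R : L [⋀^Fin 2]→ₗ[C] S) (i : ℕ) : ofAlt (wedgePow R i) = ofAlt R ^ i := by
  induction i with
  | zero => exact ofAlt_constOfIsEmpty_one
  | succ i ih => rw [pow_succ, ← ih]; exact ofAlt_wedge (wedgePow R i) R

lemma ε_ofAlt_of_even {k : ℕ} (h : Even k) (θ : L [⋀^Fin k]→ₗ[C] N) : ε (ofAlt θ) = ofAlt θ := by
  rw [ε_ofAlt, h.neg_one_pow, one_smul]

/-- The list forms which come from alternating maps of degree `k`. -/
def IsAlt (C : Type*) [CommRing C] {L S : Type*} [AddCommGroup L] [Module C L] [AddCommGroup S]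
    [Module C S] (k : ℕ) (f : ListForm L S) : Prop := ∃ θ : L [⋀^Fin k]→ₗ[C] S, ofAlt θ = f

lemma IsAlt.add {k : ℕ} {f g : ListForm L N} (hf : IsAlt C k f) (hg : IsAlt C k g) :
    IsAlt C k (f + g) := by
  obtain ⟨θ, rfl⟩ := hf
  obtain ⟨η, rfl⟩ := hg
  exact ⟨θ + η, ofAlt_add _ _⟩

lemma IsAlt.sub {k : ℕ} {f g : ListForm L N} (hf : IsAlt C k f) (hg : IsAlt C k g) :
    IsAlt C k (f - g) := by
  obtain ⟨θ, rfl⟩ := hf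
  obtain ⟨η, rfl⟩ := hg
  exact ⟨θ - η, map_sub (ofAltHom C L N k) _ _⟩

lemma isAlt_zero (k : ℕ) : IsAlt C k (0 : ListForm L N) := ⟨0, map_zero (ofAltHom C L N k)⟩

lemma IsAlt.mul {S : Type*} [Ring S] [Algebra C S] [IsAddTorsionFree S] {k m : ℕ}
    {f g : ListForm L S} (hf : IsAlt C k f) (hg : IsAlt C m g) : IsAlt C (k + m) (f * g) := by
  obtain ⟨θ, rfl⟩ := hf
  obtain ⟨η, rfl⟩ := hg
  exact ⟨wedge θ η, ofAlt_wedge _ _⟩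

/-- Exactness asks for a `C`-multilinear alternating primitive, so the forms met in the
transgression must be known to come from alternating maps. -/
lemma isAlt_coeff_curvaturePoly_pow {S : Type*} [Ring S] [Algebra C S] [IsAddTorsionFree S]
    {R F η : ListForm L S} (hR : IsAlt C 2 R) (hF : IsAlt C 2 F) (hη : IsAlt C 1 η) (n m : ℕ) :
    IsAlt C (2 * n) ((curvaturePoly R F η ^ n).coeff m) := by
  induction n generalizing m with
  | zero =>
    rw [pow_zero, Polynomial.coeff_one]
    split_ifs
    · exact ⟨_, ofAlt_constOfIsEmpty_one⟩
    · exact isAlt_zero _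
  | succ n ih =>
    rw [pow_succ, Polynomial.coeff_mul]
    refine Finset.sum_induction _ (IsAlt C (2 * (n + 1))) (fun _ _ => IsAlt.add) (isAlt_zero _)
      fun x _ => (ih x.1).mul ?_
    rw [coeff_curvaturePoly]
    rcases x.2 with _ | _ | _ | m
    exacts [hR, hF, hη.mul hη, isAlt_zero _]

end IsAlt

/-! ### Chern–Weil theory: independence of the connection. -/

section ChernWeil
open ListForm

variable {C L N : Type*} [CommRing C] [LieRing L] [Module C L] [LieRingModule L C]
  [AddCommGroup N] [Module C N] [Algebra ℝ C] [LieAlgebra ℝ L] [LieRinehartRing C L]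
  [LieRinehartAlgebra ℝ C L] [Module ℝ N] [IsScalarTower ℝ C N]

variable (tr : Module.End C N →ₗ[C] C)

omit [LieAlgebra ℝ L] [LieRinehartAlgebra ℝ C L] in
lemma ofAlt_characterForm (D : Connection C L N) (i : ℕ) :
    ofAlt (characterForm tr D i) = map tr.toAddMonoidHom (ofAlt D.curvature ^ i) := by
  have : IsAddTorsionFree (Module.End C N) := isAddTorsionFree_of_real _
  rw [characterForm, ofAlt_comp, ofAlt_wedgePow]

variable (htr : ∀ (D : Connection C L N) (a : L) (φ : Module.End C N),
  tr ((D.hom D) a φ) = ⁅a, tr φ⁆)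

omit [Algebra ℝ C] [LieAlgebra ℝ L] [LieRinehartAlgebra ℝ C L] [Module ℝ N]
  [IsScalarTower ℝ C N] in
include htr in
lemma map_tr_d (D : Connection C L N) (f : ListForm L (Module.End C N)) :
    map tr.toAddMonoidHom (d (D.hom D).op f) =
      d (Connection.trivial C L).op (map tr.toAddMonoidHom f) :=
  map_d _ _ _ (fun a φ => htr D a φ) f

-- Bianchi and Leibniz give `d_∇ R^i = 0`, and a parallel trace commutes with the differentials.
omit [LieAlgebra ℝ L] [LieRinehartAlgebra ℝ C L] in
include htr in
lemma d_characterForm (D : Connection C L N) (i : ℕ) :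
    d (Connection.trivial C L).op (ofAlt (characterForm tr D i)) = 0 := by
  rw [ofAlt_characterForm, ← map_tr_d tr htr]
  have : d (D.hom D).op (ofAlt D.curvature ^ i) = 0 := by
    induction i with
    | zero => rw [pow_zero, d_one _ D.hom_op_mul]
    | succ i ih => rw [pow_succ, d_mul _ D.hom_op_mul, ih, D.d_curvature, zero_mul, mul_zero, add_zero]
  rw [this, map_zero]

include htr in
lemma IsPontryaginForm.mem_closedForms {D : Connection C L N} {l : ℕ} {θ : L [⋀^Fin l]→ₗ[C] C}
    (h : IsPontryaginForm tr D l θ) : θ ∈ closedForms (Connection.trivial C L) l := by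
  have : IsAddTorsionFree C := isAddTorsionFree_of_real _
  rw [mem_closedForms_iff]
  induction h with
  | one => rw [ofAlt_constOfIsEmpty_one, d_one _ Connection.trivial_op_mul]
  | mul hi hθ ih =>
    rw [ofAlt_wedge, d_mul _ Connection.trivial_op_mul, ih, d_characterForm tr htr, zero_mul,
      mul_zero, add_zero]

variable (hτ : ∀ φ ψ, tr (φ * ψ) = tr (ψ * φ))

include htr hτ in
/-- The class of `tr(R_∇^i)` does not depend on the connection. -/
theorem characterForm_sub_mem_exactForms (D₁ D₀ : Connection C L N) (i : ℕ) :
    characterForm tr D₁ i - characterForm tr D₀ i ∈ exactForms (Connection.trivial C L) (2 * i) := by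
  have : IsAddTorsionFree (Module.End C N) := isAddTorsionFree_of_real _
  cases i with
  | zero =>
    have h : characterForm tr D₁ 0 = characterForm tr D₀ 0 := rfl
    rw [h, sub_self]
    exact Submodule.zero_mem _
  | succ n =>
  set R := ofAlt D₀.curvature with hRdef
  set η := ofAlt (D₁.sub D₀) with hηdef
  set F := d (D₀.hom D₀).op η with hF
  have hR : ε R = R := ε_ofAlt_of_even even_two _
  have hη : ε η = -η := by rw [hηdef, ε_ofAlt, pow_one, neg_one_smul]
  have hRalt : IsAlt C 2 R := ⟨_, rfl⟩
  have hηalt : IsAlt C 1 η := ⟨_, rfl⟩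
  have hR1 : ofAlt D₁.curvature = R + F + η * η := ofAlt_curvature_eq D₁ D₀
  -- The structure equation expresses `dη` through forms known to be alternating, so no general
  -- statement that `d` preserves alternating maps is needed.
  have hFalt : IsAlt C 2 F := by
    have : F = ofAlt D₁.curvature - R - η * η := by rw [hR1]; abel
    rw [this]
    exact (IsAlt.sub ⟨_, rfl⟩ hRalt).sub (hηalt.mul hηalt)
  have hdF : d (D₀.hom D₀).op F = R * η - η * R := d_d_sub D₁ D₀
  set P := curvaturePoly R F η with hP
  set τ := tr.toAddMonoidHom
  have key := map_coeff_succ_curvaturePoly_pow (τ := τ) D₀.hom_op_mul hR hη D₀.d_curvature rfl hdF hτ n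
  have hPalt := isAlt_coeff_curvaturePoly_pow hRalt hFalt hηalt
  choose γ hγ using fun m => hPalt (n + 1) (m + 1)
  choose β hβ using fun m => hηalt.mul (hPalt n m)
  have hex : ∀ m, tr.compAlternatingMap (γ m) ∈ exactForms (Connection.trivial C L) (2 * (n + 1)) := by
    intro m
    have hm : ((m + 1 : ℕ) : ℝ) ≠ 0 := by positivity
    -- Division by `m + 1` over the reals; the primitive of the multiple is `(n + 1) tr(η P^n)` in
    -- its coefficient `m`.
    rw [← Submodule.smul_mem_iff _ hm, Nat.cast_smul_eq_nsmul, mem_exactForms_iff]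
    refine .inr ⟨1 + 2 * n, (n + 1) • tr.compAlternatingMap (β m), by omega, ?_⟩
    rw [← ofAltHom_apply, ← ofAltHom_apply, map_nsmul, map_nsmul, map_nsmul, ofAltHom_apply, ofAltHom_apply,
      ofAlt_comp, ofAlt_comp, hγ, hβ, ← map_tr_d tr htr]
    exact key m
  -- The value of `P^(n+1)` at `1` minus its constant coefficient.
  have hsum : characterForm tr D₁ (n + 1) - characterForm tr D₀ (n + 1) =
      ∑ m ∈ Finset.range (P ^ (n + 1)).natDegree, tr.compAlternatingMap (γ m) := by
    refine ofAlt_injective ?_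
    have h := sum_coeff_pow P (n + 1)
    rw [Finset.sum_range_succ'] at h
    have hP1 : P.eval 1 = R + F + η * η := by simp [hP, curvaturePoly]
    have hP0 : (P ^ (n + 1)).coeff 0 = R ^ (n + 1) := by
      have : (P ^ (n + 1)).coeff 0 = P.coeff 0 ^ (n + 1) := map_pow Polynomial.constantCoeff P (n + 1)
      rw [this, coeff_curvaturePoly]
    rw [hP1, ← hR1, hP0] at h
    rw [← ofAltHom_apply, ← ofAltHom_apply, map_sub, map_sum, ofAltHom_apply, ofAltHom_apply, ofAlt_characterForm,
      ofAlt_characterForm, ← h, map_add, add_sub_cancel_right, map_sum]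
    refine Finset.sum_congr rfl fun m _ => ?_
    rw [ofAltHom_apply, ofAlt_comp, hγ]
  rw [hsum]
  exact Submodule.sum_mem _ fun m _ => hex m

include htr hτ in
/-- Every product of the forms `tr(R_∇^i)` is cohomologous to the product of the same forms for
another connection. -/
theorem IsPontryaginForm.exists_sub_mem_exactForms {D₁ : Connection C L N} (D₀ : Connection C L N)
    {l : ℕ} {θ : L [⋀^Fin l]→ₗ[C] C} (h : IsPontryaginForm tr D₁ l θ) :
    ∃ θ₀, IsPontryaginForm tr D₀ l θ₀ ∧ θ - θ₀ ∈ exactForms (Connection.trivial C L) l := by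
  have : IsAddTorsionFree C := isAddTorsionFree_of_real _
  induction h with
  | one => exact ⟨_, .one, by rw [sub_self]; exact zero_mem _⟩
  | @mul i l θ hi hθ ih =>
    obtain ⟨θ₀, hθ₀, hex⟩ := ih
    refine ⟨_, .mul hi hθ₀, ?_⟩
    -- Change one factor at a time: each summand is then a product of an exact and a closed form.
    have hsplit : wedge (characterForm tr D₁ i) θ - wedge (characterForm tr D₀ i) θ₀ =
        wedge (characterForm tr D₁ i - characterForm tr D₀ i) θ +
          wedge (characterForm tr D₀ i) (θ - θ₀) := by
      refine ofAlt_injective ?_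
      rw [← ofAltHom_apply, map_sub, ofAlt_add]
      simp only [ofAltHom_apply, ofAlt_wedge]
      rw [← ofAltHom_apply (_ - _), ← ofAltHom_apply (_ - _), map_sub, map_sub]
      simp only [ofAltHom_apply, sub_mul, mul_sub]
      abel
    rw [hsplit]
    refine Submodule.add_mem _ ?_ ?_
    · rcases (mem_exactForms_iff _ _).1 (characterForm_sub_mem_exactForms tr htr hτ D₁ D₀ i) with
        h0 | ⟨j, β, hj, hβ⟩
      · rw [h0, mem_exactForms_iff]
        refine .inl (ofAlt_injective ?_)
        rw [ofAlt_wedge, ← ofAltHom_apply, map_zero, zero_mul, ← ofAltHom_apply, map_zero]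
      · refine (mem_exactForms_iff _ _).2 (.inr ⟨j + l, wedge β θ, by omega, ?_⟩)
        rw [ofAlt_wedge, ofAlt_wedge, d_mul _ Connection.trivial_op_mul, hβ,
          (mem_closedForms_iff _ _).1 (hθ.mem_closedForms tr htr), mul_zero, add_zero]
    · rcases (mem_exactForms_iff _ _).1 hex with h0 | ⟨j, β, hj, hβ⟩
      · rw [h0, mem_exactForms_iff]
        refine .inl (ofAlt_injective ?_)
        rw [ofAlt_wedge, ← ofAltHom_apply 0, map_zero, mul_zero, ← ofAltHom_apply, map_zero]
      -- No sign is needed, as the closed factor `tr(R^i)` has even degree.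
      · refine (mem_exactForms_iff _ _).2 (.inr ⟨2 * i + j, wedge (characterForm tr D₀ i) β,
          by omega, ?_⟩)
        rw [ofAlt_wedge, ofAlt_wedge, d_mul _ Connection.trivial_op_mul, hβ,
          d_characterForm tr htr, zero_mul, zero_add, ε_ofAlt_of_even (even_two_mul i)]

omit [LieAlgebra ℝ L] [LieRinehartAlgebra ℝ C L] in
lemma IsPontryaginForm.vanishesOn {D : Connection C L N} {B : Set L}
    (hB : VanishesOn B (ofAlt D.curvature)) {l : ℕ} {θ : L [⋀^Fin l]→ₗ[C] C}
    (h : IsPontryaginForm tr D l θ) : VanishesOn B (ofAlt θ) := by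
  have : IsAddTorsionFree C := isAddTorsionFree_of_real _
  induction h with
  | one => rw [ofAlt_constOfIsEmpty_one]; exact vanishesOn_one
  | mul hi hθ ih =>
    rw [ofAlt_wedge, ofAlt_characterForm]
    refine VanishesOn.mul (fun l hl => ?_) ih
    rw [map_apply, (hB.pow _) l hl, map_zero]

end ChernWeil

/-! ### Vanishing Atiyah class and adapted extensions. -/

section Atiyah
open ListForm

variable {C L V : Type*} [CommRing C] [LieRing L] [Module C L] [LieRingModule L C]
  [LieRinehartRing C L] {B : LieRinehartSubalgebra C L} [AddCommGroup V] [Module C V]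

/-- A connection minus a 1-form with values in the endomorphisms. -/
def Connection.subHom (D : Connection C L V) (φ : L →ₗ[C] Module.End C V) : Connection C L V where
  toFun a n := D a n - φ a n
  add_left' a b n := by rw [D.add_left, map_add, LinearMap.add_apply]; abel
  smul_left' f a n := by rw [D.smul_left, map_smul, LinearMap.smul_apply, smul_sub]
  add_right' a n m := by rw [D.add_right, map_add]; abel
  leibniz' a f n := by rw [D.leibniz, map_smul, smul_sub]; abel

lemma vanishesOn_curvature {D : Connection C L V} (h : ∀ b ∈ B, ∀ a, D.curvatureEnd b a = 0) :
    VanishesOn (B : Set L) (ofAlt D.curvature) := by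
  rintro l ⟨b, hb, hB⟩
  by_cases hl : l.length = 2
  · obtain ⟨x, y, rfl⟩ := List.length_eq_two.1 hl
    rw [ofAlt_curvature_pair]
    rcases List.mem_cons.1 hb with rfl | hb
    · exact h _ hB _
    · rw [List.mem_singleton] at hb
      subst hb
      rw [D.curvatureEnd_swap, h _ hB, neg_zero]
  · exact ofAlt_of_length_ne _ _ hl

variable [Algebra ℝ C] [LieAlgebra ℝ L] [LieRinehartAlgebra ℝ C L] [Module ℝ V] [IsScalarTower ℝ C V]

/-- If the Atiyah class vanishes, the connection has an extension whose curvature is annihilated by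
contraction with elements of `B`. -/
theorem exists_vanishesOn_curvature {D : Connection C B V} (hD : D.IsFlat)
    (hE : Nonempty (Extension D)) (hA : atiyahClass D hD = 0) :
    ∃ D' : Connection C L V, VanishesOn (B : Set L) (ofAlt D'.curvature) := by
  rw [atiyahClass, dif_pos hE] at hA
  obtain ⟨θ, hθ⟩ := (Cohomology.mk_eq_zero_iff _ _).1 hA
  set E := hE.some
  -- A primitive of a 1-form is a 0-form, that is, a single element of `Hom(L/B, End V)`.
  set φ := θ ![]
  refine ⟨E.conn.subHom (φ ∘ₗ B.toSubmodule.mkQ), vanishesOn_curvature fun b hb a => ?_⟩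
  -- Exactness, evaluated on `b`, says that `R(b, ·) = ∇_b φ`.
  have h1 : atiyahHom hD E ⟨b, hb⟩ = atiyahConnection B D ⟨b, hb⟩ φ := by
    have : atiyahHom hD E ⟨b, hb⟩ = koszul (atiyahConnection B D) θ ![⟨b, hb⟩] := hθ ![⟨b, hb⟩]
    have hr : ∀ w : Fin 0 → B, θ w = φ := fun w => congrArg θ (Subsingleton.elim _ _)
    simpa [koszul, hr] using this
  ext e
  have h2 := congrArg (fun ψ => ψ (B.toSubmodule.mkQ a) e) h1
  have h3 : atiyahConnection B D ⟨b, hb⟩ φ (B.toSubmodule.mkQ a) e =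
      D ⟨b, hb⟩ (φ (B.toSubmodule.mkQ a) e) - φ (B.toSubmodule.mkQ a) (D ⟨b, hb⟩ e) -
        φ (B.toSubmodule.mkQ ⁅b, a⁆) e := rfl
  rw [atiyahHom_mk, h3, Connection.curvatureEnd_apply] at h2
  -- The correction vanishes on `B`, so the new connection still restricts to `D` and the terms
  -- quadratic in `φ` drop out of its curvature on `(b, a)`.
  have hb0 : B.toSubmodule.mkQ b = 0 := (Submodule.Quotient.mk_eq_zero _).2 hb
  have hc : ∀ e, E.conn b e = D ⟨b, hb⟩ e := fun e => E.apply_coe ⟨b, hb⟩ e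
  have hs : ∀ x e, (E.conn.subHom (φ ∘ₗ B.toSubmodule.mkQ)) x e =
    E.conn x e - φ (B.toSubmodule.mkQ x) e := fun _ _ => rfl
  simp only [hc] at h2
  simp only [Connection.curvatureEnd_apply, hs, hb0, map_zero, LinearMap.zero_apply, sub_zero, hc,
    Connection.sub_right]
  rw [sub_eq_iff_eq_add, sub_eq_iff_eq_add] at h2
  rw [h2]
  abel

end Atiyah

/-! ### Local frames, dual functionals and pointwise dependence. -/

section LocalFrames

variable {d : ℕ} {M : Type*} [TopologicalSpace M] [ChartedSpace (EuclideanSpace ℝ (Fin d)) M]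
  {F : Type*} [NormedAddCommGroup F] [NormedSpace ℝ F]
  {E : M → Type*} [TopologicalSpace (TotalSpace F E)] [∀ x, TopologicalSpace (E x)]
  [∀ x, AddCommGroup (E x)] [∀ x, Module ℝ (E x)] [FiberBundle F E] [VectorBundle ℝ F E]

lemma sum_section_apply {ι : Type*} (s : Finset ι) (t : ι → Cₛ^∞⟮𝓡 d; F, E⟯) (x : M) :
    (∑ i ∈ s, t i) x = ∑ i ∈ s, t i x :=
  (congrFun (map_sum (ContMDiffSection.coeAddHom (𝓡 d) F ∞ E) t s) x).trans (Finset.sum_apply _ _ _)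

lemma sum_smooth_apply {ι : Type*} (s : Finset ι) (t : ι → C^∞⟮𝓡 d, M; ℝ⟯) (x : M) :
    (∑ i ∈ s, t i) x = ∑ i ∈ s, t i x :=
  map_sum (ContMDiffMap.evalRingHom x : C^∞⟮𝓡 d, M; ℝ⟯ →+* ℝ) t s

variable [IsManifold (𝓡 d) ∞ M] [T2Space M]

lemma exists_cutoff {x : M} {p : M → Prop} (hp : ∀ᶠ y in 𝓝 x, p y) :
    ∃ χ : C^∞⟮𝓡 d, M; ℝ⟯, (∀ᶠ y in 𝓝 x, χ y = 1) ∧ ∀ y, χ y ≠ 0 → p y := by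
  obtain ⟨χ, -, hχ⟩ := (SmoothBumpFunction.nhds_basis_tsupport (I := 𝓡 d) x).mem_iff.1 hp
  exact ⟨⟨χ, χ.contMDiff⟩, χ.eventuallyEq_one, fun y hy => hχ (subset_tsupport _ hy)⟩

/-- A smooth function that does not vanish at `x` has a smooth inverse near `x`. -/
lemma exists_local_inverse {x : M} (h : C^∞⟮𝓡 d, M; ℝ⟯) (hx : h x ≠ 0) :
    ∃ u : C^∞⟮𝓡 d, M; ℝ⟯, ∀ᶠ y in 𝓝 x, u y * h y = 1 := by
  have hne : ∀ᶠ y in 𝓝 x, h y ≠ 0 := h.contMDiff.continuous.continuousAt.eventually_ne hx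
  obtain ⟨χ, -, hχ⟩ := (SmoothBumpFunction.nhds_basis_tsupport (I := 𝓡 d) x).mem_iff.1 hne
  refine ⟨⟨fun y => χ y / h y, fun y => ?_⟩, ?_⟩
  · by_cases hy : h y = 0
    · refine (contMDiffAt_const (c := (0 : ℝ))).congr_of_eventuallyEq ?_
      have : y ∉ tsupport χ := fun hy' => hχ hy' hy
      filter_upwards [notMem_tsupport_iff_eventuallyEq.1 this] with z hz
      simp [hz]
    · exact χ.contMDiff.contMDiffAt.div₀ h.contMDiff.contMDiffAt hy
  · filter_upwards [χ.eventuallyEq_one, hne] with y hy hy'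
    change χ y / h y * h y = 1
    rw [div_mul_cancel₀ _ hy', hy]; rfl

variable [FiniteDimensional ℝ F] [ContMDiffVectorBundle ∞ F E (𝓡 d)]

/-- Fibrewise linear coordinates on smooth sections, which separate points of the fibre at `x`. -/
lemma exists_coordinates (x : M) :
    ∃ (n : ℕ) (κ : Fin n → Cₛ^∞⟮𝓡 d; F, E⟯ →ₗ[C^∞⟮𝓡 d, M; ℝ⟯] C^∞⟮𝓡 d, M; ℝ⟯)
      (ℓ : Fin n → (y : M) → E y →ₗ[ℝ] ℝ), (∀ i a y, κ i a y = ℓ i y (a y)) ∧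
      ∀ v : E x, (∀ i, ℓ i x v = 0) → v = 0 := by
  obtain ⟨χ, S, h1, h0, hS⟩ := exists_cutoff_frame (d := d) (F := F) (E := E) x
  have hx := mem_baseSet_trivializationAt F E x
  set e := trivializationAt F E x
  set b := Module.finBasis ℝ F
  have : ContMDiffVectorBundle 1 F E (𝓡 d) := ContMDiffVectorBundle.of_le (n := ∞) (by simp)
  have hsm : ∀ i (s : Cₛ^∞⟮𝓡 d; F, E⟯), ContMDiff (𝓡 d) 𝓘(ℝ, ℝ) ∞
      fun y => χ y * e.localFrameCoeff (𝓡 d) b i y (s y) := by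
    intro i s y
    by_cases hy : y ∈ e.baseSet
    · exact χ.contMDiff.contMDiffAt.mul (contMDiffAt_localFrameCoeff b hy s.contMDiff.contMDiffAt i)
    · refine (contMDiffAt_const (c := (0 : ℝ))).congr_of_eventuallyEq ?_
      filter_upwards [h0 y hy] with z hz
      simp [hz]
  refine ⟨_, fun i =>
    { toFun := fun s => ⟨_, hsm i s⟩
      map_add' := fun s t => ?_
      map_smul' := fun f s => ?_ }, fun i y => χ y • e.localFrameCoeff (𝓡 d) b i y,
    fun i a y => rfl, fun v hv => ?_⟩
  · ext y
    change χ y * e.localFrameCoeff (𝓡 d) b i y (s y + t y) =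
      χ y * e.localFrameCoeff (𝓡 d) b i y (s y) + χ y * e.localFrameCoeff (𝓡 d) b i y (t y)
    rw [map_add, mul_add]
  · ext y
    change χ y * e.localFrameCoeff (𝓡 d) b i y (f y • s y) =
      f y * (χ y * e.localFrameCoeff (𝓡 d) b i y (s y))
    rw [map_smul, smul_eq_mul, mul_left_comm]
  · obtain ⟨s, rfl⟩ := exists_section_eq (d := d) (F := F) x v
    rw [e.eq_sum_localFrameCoeff_smul (I := 𝓡 d) (b := b) (s := s) hx]
    refine Finset.sum_eq_zero fun i _ => ?_
    have := hv i
    rw [LinearMap.smul_apply, h1.self_of_nhds, one_smul] at this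
    rw [this, zero_smul]

/-- The coordinates embed `E x` in `ℝ^n`. A left inverse there of the combinations of the `v j`
gives constant coefficients with which to combine the coordinates; duality holds only at `x`. -/
lemma exists_dual_functionals {x : M} {r : ℕ} {v : Fin r → E x} (hv : LinearIndependent ℝ v) :
    ∃ (g : Fin r → Cₛ^∞⟮𝓡 d; F, E⟯ →ₗ[C^∞⟮𝓡 d, M; ℝ⟯] C^∞⟮𝓡 d, M; ℝ⟯)
      (ℓ : Fin r → (y : M) → E y →ₗ[ℝ] ℝ), (∀ i a y, g i a y = ℓ i y (a y)) ∧
      ∀ i j, ℓ i x (v j) = if i = j then 1 else 0 := by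
  obtain ⟨n, κ, ℓ, hκ, hℓ⟩ := exists_coordinates (d := d) (F := F) (E := E) x
  set ev : E x →ₗ[ℝ] (Fin n → ℝ) := LinearMap.pi fun i => ℓ i x
  have hev : Function.Injective ev := by
    rw [← LinearMap.ker_eq_bot, LinearMap.ker_eq_bot']
    exact fun w hw => hℓ w fun i => congrFun hw i
  have hw : LinearIndependent ℝ (ev ∘ v) := hv.map' ev (LinearMap.ker_eq_bot.2 hev)
  obtain ⟨Λ, hΛ⟩ := (Fintype.linearCombination ℝ (ev ∘ v)).exists_leftInverse_of_injective
    (LinearMap.ker_eq_bot.2 (linearIndependent_iff_injective_fintypeLinearCombination.1 hw))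
  refine ⟨fun j => ∑ i, algebraMap ℝ C^∞⟮𝓡 d, M; ℝ⟯ (Λ (Pi.single i 1) j) • κ i,
    fun j y => ∑ i, Λ (Pi.single i 1) j • ℓ i y, fun j a y => ?_, fun j k => ?_⟩
  · rw [LinearMap.sum_apply, sum_smooth_apply, LinearMap.sum_apply]
    exact Finset.sum_congr rfl fun i _ => congrArg _ (hκ i a y)
  · have h1 : Λ (ev (v k)) = Pi.single k 1 := by
      have := LinearMap.congr_fun hΛ (Pi.single k 1)
      simpa [Fintype.linearCombination_apply_single] using this
    have h2 : Λ (ev (v k)) j = ∑ i, Λ (Pi.single i 1) j * ℓ i x (v k) := by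
      rw [LinearMap.pi_apply_eq_sum_univ Λ (ev (v k)), Finset.sum_apply]
      refine Finset.sum_congr rfl fun i _ => ?_
      have hi : (fun j => if i = j then (1 : ℝ) else 0) = Pi.single i 1 := by
        ext j
        simp [Pi.single_apply, eq_comm]
      rw [hi, Pi.smul_apply, smul_eq_mul, mul_comm]
      rfl
    rw [LinearMap.sum_apply]
    simp only [LinearMap.smul_apply, smul_eq_mul]
    rw [← h2, h1, Pi.single_apply]

/-- Sections `s₁, …, s_r` which are linearly independent at `x` have, near `x`, dual functionals on
the sections of the ambient bundle. -/
lemma exists_dual_frame {x : M} {r : ℕ} (s : Fin r → Cₛ^∞⟮𝓡 d; F, E⟯)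
    (hs : LinearIndependent ℝ fun i => s i x) :
    ∃ (f : Fin r → Cₛ^∞⟮𝓡 d; F, E⟯ →ₗ[C^∞⟮𝓡 d, M; ℝ⟯] C^∞⟮𝓡 d, M; ℝ⟯),
      (∀ᶠ y in 𝓝 x, ∀ a : Cₛ^∞⟮𝓡 d; F, E⟯, a y ∈ Submodule.span ℝ (Set.range fun i => s i y) →
        ∑ j, f j a y • s j y = a y) ∧ ∀ j a y, a y = 0 → f j a y = 0 := by
  obtain ⟨g, ℓ, hg, hℓ⟩ := exists_dual_functionals (d := d) (F := F) hs
  -- `G` is the identity at `x`, hence invertible nearby, where the inverse is `u` times the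
  -- adjugate; applying it to the `g k` makes them dual to `s` at all nearby points.
  let G : Matrix (Fin r) (Fin r) C^∞⟮𝓡 d, M; ℝ⟯ := Matrix.of fun i j => g i (s j)
  have hGx : ∀ y, G.det y = (Matrix.of fun i j => ℓ i y (s j y)).det := fun y => by
    have := RingHom.map_det (ContMDiffMap.evalRingHom y : C^∞⟮𝓡 d, M; ℝ⟯ →+* ℝ) G
    refine this.trans (congrArg Matrix.det ?_)
    ext i j
    exact hg i (s j) y
  have hdet : G.det x ≠ 0 := by
    have : (Matrix.of fun i j => ℓ i x (s j x)) = (1 : Matrix (Fin r) (Fin r) ℝ) := by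
      ext i j
      rw [Matrix.of_apply, hℓ, Matrix.one_apply]
    rw [hGx, this, Matrix.det_one]
    exact one_ne_zero
  obtain ⟨u, hu⟩ := exists_local_inverse G.det hdet
  refine ⟨fun j => u • ∑ k, G.adjugate j k • g k, ?_, fun j a y ha => ?_⟩
  · filter_upwards [hu] with y hy a ha
    obtain ⟨c, hc⟩ := (Submodule.mem_span_range_iff_exists_fun ℝ).1 ha
    have h1 : ∀ k, g k a y = ∑ i, G k i y * c i := fun k => by
      rw [hg, ← hc, map_sum]
      refine Finset.sum_congr rfl fun i _ => ?_
      rw [map_smul, smul_eq_mul, mul_comm]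
      exact congrArg (· * c i) (hg k (s i) y).symm
    have h2 : ∀ j i, ∑ k, G.adjugate j k y * G k i y = if j = i then G.det y else 0 := fun j i => by
      have := congrFun (congrFun G.adjugate_mul j) i
      rw [Matrix.mul_apply] at this
      have h3 := congrArg (fun f : C^∞⟮𝓡 d, M; ℝ⟯ => f y) this
      beta_reduce at h3
      rw [sum_smooth_apply] at h3
      refine h3.trans ?_
      rw [Matrix.smul_apply, Matrix.one_apply]
      split_ifs
      · rw [smul_eq_mul, mul_one]
      · rw [smul_zero]; rfl
    have h4 : ∀ j, (u • ∑ k, G.adjugate j k • g k) a y = c j := fun j => by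
      have : (u • ∑ k, G.adjugate j k • g k) a y = u y * ∑ k, G.adjugate j k y * g k a y := by
        rw [LinearMap.smul_apply, LinearMap.sum_apply]
        exact congrArg (u y * ·) (sum_smooth_apply _ _ y)
      rw [this]
      simp only [h1, Finset.mul_sum]
      rw [Finset.sum_comm]
      simp only [← mul_assoc, ← Finset.sum_mul]
      simp only [mul_assoc (u y), ← Finset.mul_sum, h2]
      simp only [ite_mul, zero_mul, Finset.sum_ite_eq, Finset.mem_univ, if_true]
      rw [← mul_assoc, hy, one_mul]
    simp only [h4, hc]
  · rw [LinearMap.smul_apply, LinearMap.sum_apply]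
    refine (congrArg (u y * ·) (sum_smooth_apply _ _ y)).trans ?_
    rw [Finset.sum_eq_zero, mul_zero]
    intro k _
    change G.adjugate j k y * g k a y = 0
    rw [hg, ha, map_zero, mul_zero]

/-- A local frame near `x` by global sections, with dual functionals. -/
lemma exists_frame_dual_frame (x : M) :
    ∃ (n : ℕ) (s : Fin n → Cₛ^∞⟮𝓡 d; F, E⟯)
      (f : Fin n → Cₛ^∞⟮𝓡 d; F, E⟯ →ₗ[C^∞⟮𝓡 d, M; ℝ⟯] C^∞⟮𝓡 d, M; ℝ⟯),
      (∀ᶠ y in 𝓝 x, ∀ a : Cₛ^∞⟮𝓡 d; F, E⟯, ∑ j, f j a y • s j y = a y) ∧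
        ∀ j a y, a y = 0 → f j a y = 0 := by
  obtain ⟨χ, S, h1, -, hS⟩ := exists_cutoff_frame (d := d) (F := F) (E := E) x
  have hx := mem_baseSet_trivializationAt F E x
  set e := trivializationAt F E x
  set b := Module.finBasis ℝ F
  have hSy : ∀ᶠ y in 𝓝 x, ∃ hy : y ∈ e.baseSet, (fun i => S i y) = e.basisAt b hy := by
    filter_upwards [h1, e.open_baseSet.mem_nhds hx] with y hy1 hy
    refine ⟨hy, funext fun i => ?_⟩
    rw [hS, hy1, one_smul, e.localFrame_apply_of_mem_baseSet b hy]
  obtain ⟨hx', hSx⟩ := hSy.self_of_nhds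
  obtain ⟨f, hf, hf0⟩ := exists_dual_frame (d := d) (F := F) (E := E) (x := x) S (by
    rw [hSx]; exact (e.basisAt b hx').linearIndependent)
  refine ⟨_, S, f, ?_, hf0⟩
  filter_upwards [hf, hSy] with y hy ⟨hy', hSy⟩ a
  refine hy a ?_
  rw [hSy, (e.basisAt b hy').span_eq]
  trivial

/-- A functional `φ` on smooth sections is pointwise: `φ a x` only depends on `a x`. -/
lemma functional_apply_eq_zero (φ : Cₛ^∞⟮𝓡 d; F, E⟯ →ₗ[C^∞⟮𝓡 d, M; ℝ⟯] C^∞⟮𝓡 d, M; ℝ⟯)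
    (a : Cₛ^∞⟮𝓡 d; F, E⟯) (x : M) (ha : a x = 0) : φ a x = 0 := by
  obtain ⟨n, s, f, hf, hf0⟩ := exists_frame_dual_frame (d := d) (F := F) (E := E) x
  obtain ⟨χ, h1, hχ⟩ := exists_cutoff (d := d) hf
  -- The cutoff turns the local frame expansion into a global identity of sections, to which the
  -- `C`-linear `φ` can be applied.
  have h : χ • a = ∑ j, (χ * f j a) • s j := by
    ext y
    rw [sum_section_apply]
    by_cases hy : χ y = 0
    · refine Eq.trans (b := 0) ?_ (Finset.sum_eq_zero fun j _ => ?_).symm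
      · rw [smoothSections_smul_apply, hy, zero_smul]
      · rw [smoothSections_smul_apply]
        change (χ y * f j a y) • _ = 0
        rw [hy, zero_mul, zero_smul]
    · rw [smoothSections_smul_apply, ← hχ y hy a, Finset.smul_sum]
      exact Finset.sum_congr rfl fun j _ => smul_smul _ _ _
  have h2 := congrArg (fun t => φ t x) h
  simp only [map_smul, map_sum] at h2
  rw [sum_smooth_apply] at h2
  change χ x * φ a x = ∑ j, χ x * f j a x * φ (s j) x at h2
  simpa [h1.self_of_nhds, hf0 _ a x ha] using h2

end LocalFrames

/-! ### The fibrewise trace is cyclic and parallel. -/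

section FiberTrace

variable {d : ℕ} {M : Type*} [TopologicalSpace M] [ChartedSpace (EuclideanSpace ℝ (Fin d)) M]
  {F : Type*} [NormedAddCommGroup F] [NormedSpace ℝ F]
  {E : M → Type*} [TopologicalSpace (TotalSpace F E)] [∀ x, TopologicalSpace (E x)]
  [∀ x, AddCommGroup (E x)] [∀ x, Module ℝ (E x)] [FiberBundle F E] [VectorBundle ℝ F E]
  [IsManifold (𝓡 d) ∞ M] [T2Space M] [FiniteDimensional ℝ F] [ContMDiffVectorBundle ∞ F E (𝓡 d)]

lemma fiberTrace_apply (φ : Module.End C^∞⟮𝓡 d, M; ℝ⟯ Cₛ^∞⟮𝓡 d; F, E⟯) (x : M) :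
    fiberTrace d F E φ x = LinearMap.trace ℝ (E x) (endFiber φ x) := rfl

lemma endFiber_mul (φ ψ : Module.End C^∞⟮𝓡 d, M; ℝ⟯ Cₛ^∞⟮𝓡 d; F, E⟯) (x : M) :
    endFiber (φ * ψ) x = endFiber φ x * endFiber ψ x := by
  ext v
  obtain ⟨s, rfl⟩ := exists_section_eq (d := d) (F := F) x v
  rw [Module.End.mul_apply, endFiber_apply, endFiber_apply, endFiber_apply]
  rfl

lemma fiberTrace_mul_comm (φ ψ : Module.End C^∞⟮𝓡 d, M; ℝ⟯ Cₛ^∞⟮𝓡 d; F, E⟯) :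
    fiberTrace d F E (φ * ψ) = fiberTrace d F E (ψ * φ) := by
  ext x
  rw [fiberTrace_apply, fiberTrace_apply, endFiber_mul, endFiber_mul, LinearMap.trace_mul_comm]

/-- The trace of an endomorphism of rank one. -/
lemma fiberTrace_smulRight (g : Cₛ^∞⟮𝓡 d; F, E⟯ →ₗ[C^∞⟮𝓡 d, M; ℝ⟯] C^∞⟮𝓡 d, M; ℝ⟯)
    (s : Cₛ^∞⟮𝓡 d; F, E⟯) : fiberTrace d F E (g.smulRight s) = g s := by
  ext x
  have hfin : FiniteDimensional ℝ (E x) :=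
    ((trivializationAt F E x).linearEquivAt ℝ x
      (mem_baseSet_trivializationAt F E x)).symm.finiteDimensional
  choose t ht using exists_section_eq (d := d) (F := F) (E := E) x
  have hg : ∀ a b : Cₛ^∞⟮𝓡 d; F, E⟯, a x = b x → g a x = g b x := fun a b h => by
    have := functional_apply_eq_zero g (a - b) x (by simp [h])
    rw [map_sub] at this
    exact sub_eq_zero.1 this
  -- The functional on the fibre induced by `g`; it does not depend on the chosen sections `t v`, by
  -- `hg`.
  let p : E x →ₗ[ℝ] ℝ :=
    { toFun := fun v => g (t v) x
      map_add' := fun v w => by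
        rw [hg (t (v + w)) (t v + t w) (by rw [ht]; exact congrArg₂ (· + ·) (ht v).symm (ht w).symm),
          map_add]
        rfl
      map_smul' := fun r v => by
        rw [hg (t (r • v)) (algebraMap ℝ C^∞⟮𝓡 d, M; ℝ⟯ r • t v)
          (by rw [ht]; exact congrArg (r • ·) (ht v).symm), map_smul]
        rfl }
  have h : endFiber (g.smulRight s) x = p.smulRight (s x) := by
    ext v
    obtain ⟨a, rfl⟩ := exists_section_eq (d := d) (F := F) x v
    rw [endFiber_apply]
    change g a x • s x = g (t (a x)) x • s x
    rw [hg _ _ (ht (a x))]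
  rw [fiberTrace_apply, h, LinearMap.trace_smulRight]
  exact hg _ _ (ht (s x))

variable {L : Type*} [LieRing L] [Module C^∞⟮𝓡 d, M; ℝ⟯ L] [LieRingModule L C^∞⟮𝓡 d, M; ℝ⟯]
  [LieRinehartRing C^∞⟮𝓡 d, M; ℝ⟯ L]

/-- The trace is parallel for the induced connection on endomorphisms. -/
lemma fiberTrace_hom (D : Connection C^∞⟮𝓡 d, M; ℝ⟯ L Cₛ^∞⟮𝓡 d; F, E⟯) (a : L)
    (φ : Module.End C^∞⟮𝓡 d, M; ℝ⟯ Cₛ^∞⟮𝓡 d; F, E⟯) :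
    fiberTrace d F E ((D.hom D) a φ) = ⁅a, fiberTrace d F E φ⁆ := by
  -- For `g ⊗ s` the claim is `(∇_a g)(s) + g(∇_a s) = ρ(a)(g s)`, the definition of the dual
  -- connection.
  have rank_one : ∀ (g : Cₛ^∞⟮𝓡 d; F, E⟯ →ₗ[C^∞⟮𝓡 d, M; ℝ⟯] C^∞⟮𝓡 d, M; ℝ⟯)
      (s : Cₛ^∞⟮𝓡 d; F, E⟯), fiberTrace d F E ((D.hom D) a (g.smulRight s)) =
        ⁅a, fiberTrace d F E (g.smulRight s)⁆ := by
    intro g s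
    have h : (D.hom D) a (g.smulRight s) =
        ((D.hom (Connection.trivial _ L)) a g).smulRight s + g.smulRight (D a s) := by
      ext1 t
      rw [Connection.hom_apply]
      simp only [LinearMap.smulRight_apply, LinearMap.add_apply, Connection.hom_apply, D.leibniz,
        sub_smul]
      change _ = ⁅a, g t⁆ • s - _ + _
      abel
    rw [h, map_add, fiberTrace_smulRight, fiberTrace_smulRight, fiberTrace_smulRight,
      Connection.hom_apply, sub_add_cancel]
    rfl
  ext x
  obtain ⟨n, s, f, hf, -⟩ := exists_frame_dual_frame (d := d) (F := F) (E := E) x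
  obtain ⟨χ, h1, hχ⟩ := exists_cutoff (d := d) hf
  -- Near `x` the endomorphism `φ` equals this sum of rank one endomorphisms, by the frame
  -- expansion.
  set ψ := ∑ j, (f j).smulRight (φ (s j)) with hψ
  have hψt : fiberTrace d F E ((D.hom D) a ψ) = ⁅a, fiberTrace d F E ψ⁆ := by
    have h1 := map_sum (D.hom D |>.op a) (fun j => (f j).smulRight (φ (s j))) Finset.univ
    simp only [Connection.op_apply] at h1
    rw [hψ, h1, map_sum, map_sum, lie_sum]
    exact Finset.sum_congr rfl fun j _ => rank_one _ _
  have hzero : χ • (φ - ψ) = 0 := by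
    ext1 t
    ext y
    rw [LinearMap.smul_apply, smoothSections_smul_apply]
    by_cases hy : χ y = 0
    · rw [hy, zero_smul]; rfl
    · have h2 : φ t y = ψ t y := by
        have h3 : t y = (∑ j, f j t • s j) y := by
          rw [sum_section_apply, ← hχ y hy t]
          rfl
        rw [end_apply_congr φ h3, map_sum, hψ, LinearMap.sum_apply]
        simp only [map_smul, LinearMap.smulRight_apply]
      have : (φ - ψ) t y = φ t y - ψ t y := rfl
      rw [this, h2, sub_self, smul_zero]
      rfl
  have hx : χ x = 1 := h1.self_of_nhds
  -- Both sides of the claim applied to `χ (φ - ψ) = 0`: the Leibniz terms contain the factor `tr(φ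
  -- - ψ)(x)`, which is zero by `h2`, so both sides vanish for `φ - ψ` at `x`.
  have h2 := congrArg (fun ζ => fiberTrace d F E ζ x) hzero
  have h3 := congrArg (fun ζ => fiberTrace d F E ((D.hom D) a ζ) x) hzero
  have h4 := congrArg (fun ζ => ⁅a, fiberTrace d F E ζ⁆ x) hzero
  simp only [map_smul, map_zero, (D.hom D).leibniz, (D.hom D).zero_right, map_add, smul_eq_mul,
    LieRinehartRing.leibniz_mul_right, lie_zero] at h2 h3 h4
  change χ x * fiberTrace d F E (φ - ψ) x = 0 at h2
  change χ x * fiberTrace d F E ((D.hom D) a (φ - ψ)) x + ⁅a, χ⁆ x * fiberTrace d F E (φ - ψ) x = 0 at h3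
  change χ x * ⁅a, fiberTrace d F E (φ - ψ)⁆ x + ⁅a, χ⁆ x * fiberTrace d F E (φ - ψ) x = 0 at h4
  rw [hx, one_mul] at h2 h3 h4
  rw [h2, mul_zero, add_zero] at h3 h4
  have h5 : φ = (φ - ψ) + ψ := by abel
  rw [h5, (D.hom D).add_right, map_add, map_add, lie_add, hψt]
  change fiberTrace d F E ((D.hom D) a (φ - ψ)) x + _ = ⁅a, fiberTrace d F E (φ - ψ)⁆ x + _
  rw [h3, h4]

end FiberTrace

/-! ### Gluing with a partition of unity. -/

section Gluing

variable {d : ℕ} {M : Type*} [TopologicalSpace M] [ChartedSpace (EuclideanSpace ℝ (Fin d)) M]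
  {F : Type*} [NormedAddCommGroup F] [NormedSpace ℝ F]
  {E : M → Type*} [TopologicalSpace (TotalSpace F E)] [∀ x, TopologicalSpace (E x)]
  [∀ x, AddCommGroup (E x)] [∀ x, Module ℝ (E x)] [FiberBundle F E] [VectorBundle ℝ F E]
  (ρ : SmoothPartitionOfUnity M (𝓡 d) M)

/-- The section `∑ i, ρ i • σ i`. -/
def glue (σ : M → Cₛ^∞⟮𝓡 d; F, E⟯) : Cₛ^∞⟮𝓡 d; F, E⟯ where
  toFun y := ∑ᶠ i, ρ i y • σ i y
  contMDiff_toFun := by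
    refine ContMDiff.finsum_section_of_locallyFinite (ρ.locallyFinite.subset fun i x hx => ?_)
      fun i => (ρ i).contMDiff.smul_section (σ i).contMDiff
    exact left_ne_zero_of_smul hx

variable (σ τ : M → Cₛ^∞⟮𝓡 d; F, E⟯)

lemma glue_apply (y : M) : glue ρ σ y = ∑ᶠ i, ρ i y • σ i y := rfl

omit [VectorBundle ℝ F E] in
lemma finite_support_smul (y : M) : (Function.support fun i => ρ i y • σ i y).Finite :=
  (ρ.locallyFinite.point_finite y).subset fun _ hi => left_ne_zero_of_smul hi

lemma glue_add : glue ρ (fun i => σ i + τ i) = glue ρ σ + glue ρ τ := by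
  ext y
  change ∑ᶠ i, ρ i y • (σ i y + τ i y) = _
  simp only [smul_add]
  exact finsum_add_distrib (finite_support_smul ρ σ y) (finite_support_smul ρ τ y)

lemma glue_smul (f : C^∞⟮𝓡 d, M; ℝ⟯) : glue ρ (fun i => f • σ i) = f • glue ρ σ := by
  ext y
  rw [smoothSections_smul_apply, glue_apply, glue_apply, smul_finsum' _ (finite_support_smul ρ σ y)]
  refine finsum_congr fun i => ?_
  rw [smoothSections_smul_apply, smul_comm]

/-- The weights are nonnegative with sum one. The convex sets used are single points and the fibres
of `B`. -/
lemma glue_mem {y : M} {s : Set (E y)} (hs : Convex ℝ s) (h : ∀ i, ρ i y ≠ 0 → σ i y ∈ s) :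
    glue ρ σ y ∈ s :=
  hs.finsum_mem (ρ.nonneg · y) (ρ.sum_eq_one (Set.mem_univ y)) h

lemma glue_eq {a : Cₛ^∞⟮𝓡 d; F, E⟯} (h : ∀ i y, ρ i y ≠ 0 → σ i y = a y) : glue ρ σ = a := by
  ext y
  exact glue_mem ρ σ (convex_singleton (a y)) fun i hi => h i y hi

variable [IsManifold (𝓡 d) ∞ M] [T2Space M] [SigmaCompactSpace M]

lemma exists_partition {p : M → M → Prop} (hp : ∀ x, ∀ᶠ y in 𝓝 x, p x y) :
    ∃ ρ : SmoothPartitionOfUnity M (𝓡 d) M, ∀ i y, ρ i y ≠ 0 → p i y := by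
  obtain ⟨ρ, hρ⟩ := SmoothPartitionOfUnity.exists_isSubordinate (𝓡 d) isClosed_univ
    (fun x => interior {y | p x y}) (fun x => isOpen_interior)
    (fun x _ => Set.mem_iUnion.2 ⟨x, mem_interior_iff_mem_nhds.2 (hp x)⟩)
  exact ⟨ρ, fun i y hy => interior_subset (hρ i (subset_tsupport _ hy))⟩

variable [FiniteDimensional ℝ F] [ContMDiffVectorBundle ∞ F E (𝓡 d)]

/-- Every vector bundle has a connection. -/
lemma exists_connection {L : Type*} [LieRing L] [Module C^∞⟮𝓡 d, M; ℝ⟯ L]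
    [LieRingModule L C^∞⟮𝓡 d, M; ℝ⟯] [LieRinehartRing C^∞⟮𝓡 d, M; ℝ⟯ L] :
    Nonempty (Connection C^∞⟮𝓡 d, M; ℝ⟯ L Cₛ^∞⟮𝓡 d; F, E⟯) := by
  choose n s f hf hf0 using exists_frame_dual_frame (d := d) (M := M) (F := F) (E := E)
  obtain ⟨ρ, hρ⟩ := exists_partition (d := d) hf
  -- The frame expansions glue to the identity; this produces the term `ρ(a)(g) e` in the Leibniz
  -- rule of the glued connection.
  have hid : ∀ e, glue ρ (fun i => ∑ j, f i j e • s i j) = e := fun e =>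
    glue_eq ρ _ fun i y hy => by
      rw [sum_section_apply]
      exact hρ i y hy e
  exact ⟨{
    toFun := fun a e => glue ρ fun i => ∑ j, ⁅a, f i j e⁆ • s i j
    add_left' := fun a b e => by
      rw [← glue_add]
      simp only [add_lie, add_smul, Finset.sum_add_distrib]
    smul_left' := fun g a e => by
      rw [← glue_smul]
      simp only [LieRinehartRing.lie_smul_eq_mul, mul_smul, Finset.smul_sum]
    add_right' := fun a e e' => by
      rw [← glue_add]
      simp only [map_add, lie_add, add_smul, Finset.sum_add_distrib]
    leibniz' := fun a g e => by
      have h := glue_smul ρ (fun i => ∑ j, f i j e • s i j) ⁅a, g⁆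
      rw [hid] at h
      rw [← h, ← glue_smul, ← glue_add]
      simp only [map_smul, smul_eq_mul, LieRinehartRing.leibniz_mul_right, add_smul,
        Finset.smul_sum, Finset.sum_add_distrib, mul_smul] }⟩

end Gluing

/-! ### Sections of `B`, vanishing above the codimension, extensions. -/

section Subalgebroid

variable {d : ℕ} {M : Type*} [TopologicalSpace M] [ChartedSpace (EuclideanSpace ℝ (Fin d)) M]
  {F : Type*} [NormedAddCommGroup F] [NormedSpace ℝ F]
  {A : M → Type*} [TopologicalSpace (TotalSpace F A)] [∀ x, TopologicalSpace (A x)]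
  [∀ x, AddCommGroup (A x)] [∀ x, Module ℝ (A x)] [FiberBundle F A] [VectorBundle ℝ F A]
  [IsManifold (𝓡 d) ∞ M] [T2Space M] [LieAlgebroid d F A] {r : ℕ} (B : LieSubalgebroid d F A r)

/-- Near each point `B` is framed by global sections of `B`. -/
lemma LieSubalgebroid.exists_frame_sections (x : M) : ∃ s : Fin r → Cₛ^∞⟮𝓡 d; F, A⟯,
    (∀ j, s j ∈ B.sections) ∧ (LinearIndependent ℝ fun j => s j x) ∧
      ∀ᶠ y in 𝓝 x, Submodule.span ℝ (Set.range fun j => s j y) = B.fiber y := by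
  obtain ⟨s, hs⟩ := B.exists_frame x
  obtain ⟨χ, h1, hχ⟩ := exists_cutoff (d := d) hs
  have h : ∀ᶠ y in 𝓝 x, ∀ j, (χ • s j) y = s j y := by
    filter_upwards [h1] with y hy j
    rw [smoothSections_smul_apply, hy, one_smul]
  refine ⟨fun j => χ • s j, fun j y => ?_, ?_, ?_⟩
  · rw [smoothSections_smul_apply]
    by_cases hy : χ y = 0
    · rw [hy, zero_smul]
      exact zero_mem _
    · refine (B.fiber y).smul_mem _ ?_
      rw [← (hχ y hy).2]
      exact Submodule.subset_span ⟨j, rfl⟩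
  · simp only [h.self_of_nhds]
    exact hs.self_of_nhds.1
  · filter_upwards [h, hs] with y hy hs
    simp only [hy, hs.2]

lemma LieSubalgebroid.exists_section_eq {x : M} {v : A x} (hv : v ∈ B.fiber x) :
    ∃ b ∈ B.sections, b x = v := by
  obtain ⟨s, hsB, -, hs⟩ := B.exists_frame_sections x
  rw [← hs.self_of_nhds] at hv
  obtain ⟨c, rfl⟩ := (Submodule.mem_span_range_iff_exists_fun ℝ).1 hv
  refine ⟨∑ i, algebraMap ℝ C^∞⟮𝓡 d, M; ℝ⟯ (c i) • s i,
    sum_mem fun i _ => B.sections.smul_mem _ (hsB i), ?_⟩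
  rw [sum_section_apply]
  rfl

lemma LieSubalgebroid.finrank_fiber (x : M) : Module.finrank ℝ (B.fiber x) = r := by
  obtain ⟨s, -, hli, hs⟩ := B.exists_frame_sections x
  rw [← hs.self_of_nhds, finrank_span_eq_card hli, Fintype.card_fin]

variable [FiniteDimensional ℝ F] [ContMDiffVectorBundle ∞ F A (𝓡 d)]

/-- An alternating form of degree larger than the codimension of `B` which is annihilated by the
sections of `B` vanishes. -/
lemma LieSubalgebroid.eq_zero_of_vanishesOn {q l : ℕ} (hq : Module.finrank ℝ F = r + q) (hl : q < l)
    (θ : Cₛ^∞⟮𝓡 d; F, A⟯ [⋀^Fin l]→ₗ[C^∞⟮𝓡 d, M; ℝ⟯] C^∞⟮𝓡 d, M; ℝ⟯)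
    (hθ : ListForm.VanishesOn (B.sections : Set Cₛ^∞⟮𝓡 d; F, A⟯) (ListForm.ofAlt θ)) : θ = 0 := by
  ext a x
  let e := (trivializationAt F A x).linearEquivAt ℝ x (mem_baseSet_trivializationAt F A x)
  have hfin : FiniteDimensional ℝ (A x) := e.symm.finiteDimensional
  have hrank : Module.finrank ℝ (A x ⧸ B.fiber x) = q := by
    have h1 := (B.fiber x).finrank_quotient_add_finrank
    rw [B.finrank_fiber, e.finrank_eq, hq] at h1
    omega
  -- More than `q` vectors in the `q`-dimensional space `A x / B x` are dependent.
  have hdep : ¬ LinearIndependent ℝ fun i => (B.fiber x).mkQ (a i x) := fun h => by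
    have := h.fintype_card_le_finrank
    rw [hrank, Fintype.card_fin] at this
    omega
  obtain ⟨c, hc, i₀, hi₀⟩ := Fintype.not_linearIndependent_iff.1 hdep
  set t := ∑ i, algebraMap ℝ C^∞⟮𝓡 d, M; ℝ⟯ (c i) • a i with ht
  have htx : t x = ∑ i, c i • a i x := by rw [ht, sum_section_apply]; rfl
  have htB : t x ∈ B.fiber x := by
    rw [← Submodule.ker_mkQ (B.fiber x), LinearMap.mem_ker, htx, map_sum, ← hc]
    simp only [map_smul]
  obtain ⟨b, hb, hbx⟩ := B.exists_section_eq htB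
  -- At `x` the section `t` may be replaced by a section `b` of `B`, since `θ` is pointwise in each
  -- argument.
  have h1 : θ (Function.update a i₀ t) x = 0 := by
    have h2 : θ (Function.update a i₀ (t - b)) x = 0 :=
      functional_apply_eq_zero (θ.toMultilinearMap.toLinearMap a i₀) (t - b) x
        (sub_eq_zero.2 hbx.symm)
    have h3 : θ (Function.update a i₀ b) = 0 := by
      rw [← ListForm.ofAlt_ofFn]
      refine hθ _ ⟨b, ?_, hb⟩
      exact (List.mem_ofFn' _ _).2 ⟨i₀, Function.update_self _ _ _⟩
    have h4 : t = (t - b) + b := by abel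
    rw [h4, θ.map_update_add, h3, add_zero, h2]
  -- By alternation only the summand `c i₀ • a i₀` of `t` contributes.
  have h2 : θ (Function.update a i₀ t) = algebraMap ℝ C^∞⟮𝓡 d, M; ℝ⟯ (c i₀) * θ a := by
    rw [ht, θ.map_update_sum, Finset.sum_eq_single i₀]
    · rw [θ.map_update_smul, Function.update_eq_self, smul_eq_mul]
    · intro i _ hi
      rw [θ.map_update_smul, θ.map_update_self _ hi.symm, smul_zero]
    · exact fun h => absurd (Finset.mem_univ _) h
  rw [h2] at h1
  exact (mul_eq_zero.1 (h1 : c i₀ * θ a x = 0)).resolve_left hi₀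

variable [SigmaCompactSpace M]

/-- A linear projection of the sections of `A` onto those of `B`. -/
lemma LieSubalgebroid.exists_projection :
    ∃ p : Cₛ^∞⟮𝓡 d; F, A⟯ →ₗ[C^∞⟮𝓡 d, M; ℝ⟯] B.sections, ∀ b : B.sections, p b = b := by
  choose s hsB hli hspan using B.exists_frame_sections
  choose f hf hf0 using fun x => exists_dual_frame (s x) (hli x)
  obtain ⟨ρ, hρ⟩ := exists_partition (d := d) fun x => (hspan x).and (hf x)
  -- The local projection onto `B` given by a frame of `B` and its dual functionals; averages of
  -- projections onto `B` are again projections onto `B`.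
  let σ : Cₛ^∞⟮𝓡 d; F, A⟯ → M → Cₛ^∞⟮𝓡 d; F, A⟯ := fun a i => ∑ j, f i j a • s i j
  refine ⟨
    { toFun := fun a => ⟨glue ρ (σ a), fun y => glue_mem ρ _ (B.fiber y).convex fun i _ =>
        (sum_mem fun j _ => B.sections.smul_mem _ (hsB i j) : σ a i ∈ B.sections) y⟩
      map_add' := fun a b => Subtype.ext <| by
        refine Eq.trans ?_ (glue_add ρ (σ a) (σ b))
        simp only [σ, map_add, add_smul, Finset.sum_add_distrib]
      map_smul' := fun g a => Subtype.ext <| by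
        refine Eq.trans ?_ (glue_smul ρ (σ a) g)
        simp only [σ, map_smul, smul_assoc, Finset.smul_sum] }, fun b => Subtype.ext ?_⟩
  refine glue_eq ρ _ fun i y hy => ?_
  obtain ⟨h1, h2⟩ := hρ i y hy
  rw [sum_section_apply]
  exact h2 b (by rw [h1]; exact b.2 y)

variable {FE : Type*} [NormedAddCommGroup FE] [NormedSpace ℝ FE] [FiniteDimensional ℝ FE]
    {E : M → Type*} [TopologicalSpace (TotalSpace FE E)] [∀ x, TopologicalSpace (E x)]
    [∀ x, AddCommGroup (E x)] [∀ x, Module ℝ (E x)] [FiberBundle FE E] [VectorBundle ℝ FE E]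
    [ContMDiffVectorBundle ∞ FE E (𝓡 d)]

/-- Every `B`-connection extends to an `A`-connection. -/
lemma LieSubalgebroid.nonempty_extension
    (D : Connection C^∞⟮𝓡 d, M; ℝ⟯ B.sections Cₛ^∞⟮𝓡 d; FE, E⟯) : Nonempty (Extension D) := by
  obtain ⟨p, hp⟩ := B.exists_projection
  obtain ⟨D₀⟩ := exists_connection (L := Cₛ^∞⟮𝓡 d; F, A⟯) (d := d) (M := M) (F := FE) (E := E)
  have hz : ∀ e, D₀ 0 e = 0 := fun e => by simpa using D₀.smul_left 0 0 e
  refine ⟨⟨{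
    -- Use `D` along the `B`-component and an arbitrary connection along the complement; the anchor
    -- terms of the two components add up to that of `a`.
    toFun := fun a e => D₀ (a - p a) e + D (p a) e
    add_left' := fun a b e => by
      rw [map_add, D.add_left, ← add_add_add_comm, ← D₀.add_left]
      congr 2
      push_cast
      abel
    smul_left' := fun f a e => by
      rw [map_smul, D.smul_left, smul_add, ← D₀.smul_left, smul_sub]
      rfl
    add_right' := fun a e e' => by
      rw [D₀.add_right, D.add_right]
      abel
    leibniz' := fun a f e => by
      have h : ⁅a - p a, f⁆ + ⁅p a, f⁆ = ⁅a, f⁆ := by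
        change ⁅a - p a, f⁆ + ⁅(p a : Cₛ^∞⟮𝓡 d; F, A⟯), f⁆ = ⁅a, f⁆
        rw [sub_lie, sub_add_cancel]
      rw [D₀.leibniz, D.leibniz, ← h, smul_add, add_smul]
      abel }, fun b e => ?_⟩⟩
  change D₀ ((b : Cₛ^∞⟮𝓡 d; F, A⟯) - p b) e + D (p b) e = D b e
  rw [hp, sub_self, hz, zero_add]

end Subalgebroid

end LieRinehart

end

/-! ### The vanishing theorem. -/

theorem mainTheorem8
    -- the smooth manifold `M`
    {d : ℕ} {M : Type*} [TopologicalSpace M] [ChartedSpace (EuclideanSpace ℝ (Fin d)) M]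
    [IsManifold (𝓡 d) ∞ M] [T2Space M] [SigmaCompactSpace M]
    -- the Lie algebroid `A → M`
    {FA : Type*} [NormedAddCommGroup FA] [NormedSpace ℝ FA] [FiniteDimensional ℝ FA]
    {A : M → Type*} [TopologicalSpace (TotalSpace FA A)] [∀ x, TopologicalSpace (A x)]
    [∀ x, AddCommGroup (A x)] [∀ x, Module ℝ (A x)] [FiberBundle FA A] [VectorBundle ℝ FA A]
    [ContMDiffVectorBundle ∞ FA A (𝓡 d)] [LieRinehart.LieAlgebroid d FA A]
    -- the smooth vector bundle `E → M`
    {FE : Type*} [NormedAddCommGroup FE] [NormedSpace ℝ FE] [FiniteDimensional ℝ FE]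
    {E : M → Type*} [TopologicalSpace (TotalSpace FE E)] [∀ x, TopologicalSpace (E x)]
    [∀ x, AddCommGroup (E x)] [∀ x, Module ℝ (E x)] [FiberBundle FE E] [VectorBundle ℝ FE E]
    [ContMDiffVectorBundle ∞ FE E (𝓡 d)]
    -- the Lie subalgebroid `B` of codimension `q`, and its representation on `E`
    (r q : ℕ) (hq : Module.finrank ℝ FA = r + q) (B : LieRinehart.LieSubalgebroid d FA A r)
    (D : LieRinehart.Connection C^∞⟮𝓡 d, M; ℝ⟯ B.sections Cₛ^∞⟮𝓡 d; FE, E⟯)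
    (hD : D.IsFlat) (hA : LieRinehart.atiyahClass D hD = 0) :
    -- the Pontryagin forms of all `A`-connections on `E` are closed, hence define classes, and
    (∀ (D' : LieRinehart.Connection C^∞⟮𝓡 d, M; ℝ⟯ Cₛ^∞⟮𝓡 d; FA, A⟯ Cₛ^∞⟮𝓡 d; FE, E⟯) (l : ℕ)
        (θ : Cₛ^∞⟮𝓡 d; FA, A⟯ [⋀^Fin l]→ₗ[C^∞⟮𝓡 d, M; ℝ⟯] C^∞⟮𝓡 d, M; ℝ⟯),
        LieRinehart.IsPontryaginForm (LieRinehart.fiberTrace d FE E) D' l θ →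
          θ ∈ LieRinehart.closedForms (LieRinehart.Connection.trivial _ _) l) ∧
      -- the spaces that they span in cohomology vanish in degrees larger than `q`
      ∀ l : ℕ, q < l →
        (LieRinehart.pontryaginSpace (LieRinehart.fiberTrace d FE E) l :
          Submodule ℝ (LieRinehart.Cohomology
            (LieRinehart.Connection.trivial C^∞⟮𝓡 d, M; ℝ⟯ Cₛ^∞⟮𝓡 d; FA, A⟯) l)) = ⊥ := by
  refine ⟨fun D' l θ h => h.mem_closedForms _ fun D a φ => LieRinehart.fiberTrace_hom D a φ,
    fun l hl => ?_⟩
  -- Existence of an extension ensures that `hA` speaks of the class of an actual form and not of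
  -- the default value `0`.
  obtain ⟨D₀, hD₀⟩ := LieRinehart.exists_vanishesOn_curvature hD (B.nonempty_extension D) hA
  refine Submodule.span_eq_bot.2 ?_
  rintro c ⟨D', θ, hθ, h, rfl⟩
  -- Pass to the same product of trace forms for `D₀`, which vanishes identically in degree `l > q`;
  -- so `θ` itself is exact.
  obtain ⟨θ₀, h₀, hex⟩ := h.exists_sub_mem_exactForms _
    (fun D a φ => LieRinehart.fiberTrace_hom D a φ) LieRinehart.fiberTrace_mul_comm D₀
  have hz : θ₀ = 0 := B.eq_zero_of_vanishesOn hq hl θ₀ (h₀.vanishesOn _ hD₀)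
  rw [hz, sub_zero] at hex
  exact (LieRinehart.Cohomology.mk_eq_zero_iff θ hθ).2 hex
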